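/- Let $\mathcal B$ be a separable complex Banach space, $(Z_t)_{t\in\mathbb Z}$ an i.i.d. sequence of $\mathcal B$-valued random variables, $q\ge 0$ an integer, and $A_1,B_0,\dots,B_q$ continuous linear operators on $\mathcal B$ with $\sigma(A_1)\cap\{z\in\mathbb C:|z|=1\}=\emptyset$. Let $$P=\frac1{2\pi i}\oint_{|z|=1}(z-A_1)^{-1}\,dz,$$ let $\mathcal B_1$ and $\mathcal B_2$ be the images of $P$ and $\mathrm{id}-P$, and let $S:\mathcal B_1\oplus\mathcal B_2\to\mathcal B$, $S(x,y)=x+y$. Then $S$ is an isomorphism with $S^{-1}=(P,\mathrm{id}-P)$, and $S^{-1}A_1S=\begin{pmatrix}\Lambda_1&0\\0&\Lambda_2\end{pmatrix}$ with $\sigma(\Lambda_1)=\{|z|<1\}\cap\sigma(A_1)$ and $\sigma(\Lambda_2)=\{|z|>1\}\cap\sigma(A_1)$. Let $I_i$ be the projection of $\mathcal B_1\oplus\mathcal B_2$ onto its $i$-th component. A strictly stationary solution of $$Y_t-A_1Y_{t-1}=B_0Z_t+\dots+B_qZ_{t-q},\qquad t\in\mathbb Z, \tag{$*$}$$ is a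 strictly stationary $\mathcal B$-valued process $(Y_t)_{t\in\mathbb Z}$, on the probability space of $(Z_t)$, that satisfies $(*)$ almost surely for every $t$. (a) Equation $(*)$ has a strictly stationary solution if $$\mathbb E\log^+\Big\|\Big(\sum_{k=0}^qA_1^{q-k}B_k\Big)Z_0\Big\|<\infty .$$ (b) If $0\notin\sigma(A_1)$, this condition is also necessary for the existence of a strictly stationary solution. (c) Whether or not $0\in\sigma(A_1)$, a strictly stationary solution is unique: any two of them agree almost surely at every time $t$. (d) Every strictly stationary solution $Y$ is given, almost surely for each $t$, by $Y_t=S(X_t^{(1)},X_t^{(2)})$, where $$X_t^{(1)}=\sum_{j=0}^{q-1}\Big(\sum_{k=0}^{j}\Lambda_1^{j-k}I_1S^{-1}B_k\Big)Z_{t-j}+\sum_{j=q}^{\infty}\Lambda_1^{j-q}\Big(\sum_{k=0}^{q}\Lambda_1^{q-k}I_1S^{-1}B_k\Big)Z_{t-j},$$ $$X_t^{(2)}=-\sum_{j=1-q}^{\infty}\Lambda_2^{-j-q}\Big(\sum_{k=(1-j)\vee0}^{q}\Lambda_2^{q-k}I_2S^{-1}B_k\Big)Z_{t+j},$$ and both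 series converge absolutely almost surely. -/

import Mathlib

open MeasureTheory ProbabilityTheory
open scoped Real

noncomputable section

namespace ARMA

section Splitting

variable {E : Type*} [NormedAddCommGroup E] [NormedSpace ℂ E]

/-- The Riesz projection `P = (2πi)⁻¹ ∮ (z - A)⁻¹ dz` over the positively oriented unit circle
(equivalently `-(2πi)⁻¹ ∮ (A - z)⁻¹ dz`). -/
def rieszProjection (A : E →L[ℂ] E) : E →L[ℂ] E :=
  (2 * (π : ℂ) * Complex.I)⁻¹ • ∮ z in C(0, 1), resolvent A z

/-- `𝓑₁`, the image of `P`. -/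
abbrev stableSpace (A : E →L[ℂ] E) : Submodule ℂ E :=
  LinearMap.range (rieszProjection A).toLinearMap

/-- `𝓑₂`, the image of `1 - P`. -/
abbrev unstableSpace (A : E →L[ℂ] E) : Submodule ℂ E :=
  LinearMap.range (1 - rieszProjection A).toLinearMap

/-- `I₁ S⁻¹`, that is, `P` as a map onto its image. -/
def stablePart (A : E →L[ℂ] E) : E →L[ℂ] stableSpace A :=
  (rieszProjection A).codRestrict (stableSpace A) (fun x => ⟨x, rfl⟩)

/-- `I₂ S⁻¹`, that is, `1 - P` as a map onto its image. -/
def unstablePart (A : E →L[ℂ] E) : E →L[ℂ] unstableSpace A :=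
  (1 - rieszProjection A).codRestrict (unstableSpace A) (fun x => ⟨x, rfl⟩)

/-- `S : 𝓑₁ ⊕ 𝓑₂ → 𝓑`, `(x, y) ↦ x + y`. -/
def splitMap (A : E →L[ℂ] E) : (stableSpace A × unstableSpace A) →L[ℂ] E :=
  (stableSpace A).subtypeL.coprod (unstableSpace A).subtypeL

/-- `S⁻¹ = (P, 1 - P)`; that it is the two-sided inverse of `S` for hyperbolic `A` is a claim of
the theorem. -/
def splitInv (A : E →L[ℂ] E) : E →L[ℂ] (stableSpace A × unstableSpace A) :=
  (stablePart A).prod (unstablePart A)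

/-- `Λ₁`, the first diagonal entry of `S⁻¹ A S`. -/
def stableOp (A : E →L[ℂ] E) : stableSpace A →L[ℂ] stableSpace A :=
  stablePart A ∘L A ∘L (stableSpace A).subtypeL

/-- `Λ₂`, the second diagonal entry of `S⁻¹ A S`. -/
def unstableOp (A : E →L[ℂ] E) : unstableSpace A →L[ℂ] unstableSpace A :=
  unstablePart A ∘L A ∘L (unstableSpace A).subtypeL

/-- `∑_{j=0}^{q-1} (∑_{k=0}^{j} Λ₁^{j-k} I₁ S⁻¹ B_k) z_{t-j}`. -/
def stableHead (A : E →L[ℂ] E) (q : ℕ) (B : ℕ → E →L[ℂ] E) (z : ℤ → E) (t : ℤ) :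
    stableSpace A :=
  ∑ j ∈ Finset.range q,
    (∑ k ∈ Finset.range (j + 1), (stableOp A ^ (j - k)) ∘L stablePart A ∘L B k) (z (t - j))

/-- The summand with index `j = q + n` of
`∑_{j=q}^∞ Λ₁^{j-q} (∑_{k=0}^{q} Λ₁^{q-k} I₁ S⁻¹ B_k) z_{t-j}`. -/
def stableTerm (A : E →L[ℂ] E) (q : ℕ) (B : ℕ → E →L[ℂ] E) (z : ℤ → E) (t : ℤ) (n : ℕ) :
    stableSpace A :=
  (stableOp A ^ n)
    ((∑ k ∈ Finset.range (q + 1), (stableOp A ^ (q - k)) ∘L stablePart A ∘L B k)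
      (z (t - (q + n))))

/-- The summand with index `j = 1 - q + n` of
`∑_{j=1-q}^∞ Λ₂^{-j-q} (∑_{k=(1-j)∨0}^{q} Λ₂^{q-k} I₂ S⁻¹ B_k) z_{t+j}`. Here `-j - q = -(n + 1)`,
and `(1-j) ∨ 0 = (q-n) ∨ 0` is the truncated difference `q - n` of natural numbers.
The theorem claims `0 ∉ σ(Λ₂)`, so `Ring.inverse` is the inverse of `Λ₂` there. -/
def unstableTerm (A : E →L[ℂ] E) (q : ℕ) (B : ℕ → E →L[ℂ] E) (z : ℤ → E) (t : ℤ) (n : ℕ) :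
    unstableSpace A :=
  (Ring.inverse (unstableOp A) ^ (n + 1))
    ((∑ k ∈ Finset.Icc (q - n) q, (unstableOp A ^ (q - k)) ∘L unstablePart A ∘L B k)
      (z (t + (1 - q + n))))

/-- `X_t⁽¹⁾`, as a function of a path `z` of the noise. -/
def stableSol (A : E →L[ℂ] E) (q : ℕ) (B : ℕ → E →L[ℂ] E) (z : ℤ → E) (t : ℤ) :
    stableSpace A :=
  stableHead A q B z t + ∑' n : ℕ, stableTerm A q B z t n

/-- `X_t⁽²⁾`, as a function of a path `z` of the noise. -/
def unstableSol (A : E →L[ℂ] E) (q : ℕ) (B : ℕ → E →L[ℂ] E) (z : ℤ → E) (t : ℤ) :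
    unstableSpace A :=
  - ∑' n : ℕ, unstableTerm A q B z t n

end Splitting

section Processes

variable {Ω E : Type*} [MeasurableSpace Ω] [MeasurableSpace E]

/-- `(Z_t)` is an i.i.d. sequence of `E`-valued random variables. -/
structure IsIIDNoise (Z : ℤ → Ω → E) (μ : Measure Ω) : Prop where
  measurable : ∀ t, Measurable (Z t)
  indep : iIndepFun Z μ
  identDistrib : ∀ t, IdentDistrib (Z t) (Z 0) μ μ

/-- Strict stationarity: the finite-dimensional distributions are invariant under shifts. -/
def IsStrictlyStationary (Y : ℤ → Ω → E) (μ : Measure Ω) : Prop :=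
  ∀ (s : Finset ℤ) (h : ℤ),
    IdentDistrib (fun ω (i : s) => Y ((i : ℤ) + h) ω) (fun ω (i : s) => Y (i : ℤ) ω) μ μ

/-- `(Y_t)` is a strictly stationary process solving
`Y_t - A Y_{t-1} = B_0 Z_t + ⋯ + B_q Z_{t-q}`, `t ∈ ℤ`, almost surely. -/
structure IsStationarySolution [NormedAddCommGroup E] [NormedSpace ℂ E]
    (A : E →L[ℂ] E) (q : ℕ) (B : ℕ → E →L[ℂ] E) (Z Y : ℤ → Ω → E) (μ : Measure Ω) : Prop where
  measurable : ∀ t, Measurable (Y t)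
  stationary : IsStrictlyStationary Y μ
  equation : ∀ t : ℤ, ∀ᵐ ω ∂μ,
    Y t ω - A (Y (t - 1) ω) = ∑ k ∈ Finset.range (q + 1), B k (Z (t - k) ω)

/-- `𝔼 log⁺ ‖(∑_{k=0}^{q} A^{q-k} B_k) Z_0‖ < ∞`. -/
def LogMoment [NormedAddCommGroup E] [NormedSpace ℂ E]
    (A : E →L[ℂ] E) (q : ℕ) (B : ℕ → E →L[ℂ] E) (Z : ℤ → Ω → E) (μ : Measure Ω) : Prop :=
  ∫⁻ ω, ENNReal.ofReal
    (Real.posLog ‖(∑ k ∈ Finset.range (q + 1), (A ^ (q - k)) ∘L B k) (Z 0 ω)‖) ∂μ < ⊤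

end Processes

end ARMA

end

/-!
# Stationary solutions of ARMA(1, q) equations in Banach spaces

*Splitting.* For `w` off the unit circle, the Cauchy transform
`T_w = (2πi)⁻¹ ∮ (w - z)⁻¹ (z - A)⁻¹ dz` satisfies `(w - A) T_w = P` if `|w| > 1` and
`(w - A) T_w = P - 1` if `|w| < 1`. Integrating the first identity, multiplied by `(w - A)⁻¹`, over
a slightly larger circle gives `P² = P` (`isIdempotentElem_rieszProjection`). Compressed to the
range of `P` or of `1 - P`, the two identities invert `w - Λ₁` for `|w| > 1` and `w - Λ₂` for
`|w| < 1`, which determines both spectra (`spectrum_stableOp`, `spectrum_unstableOp`). By Gelfand's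
formula the powers of `Λ₁` and of `Λ₂⁻¹` then decay geometrically.

*Series representation.* Removing the finitely many summands with incomplete coefficients from a
component of a stationary solution leaves a process with `U_n = T U_{n+1} + W_n`, where `T` is `Λ₁`
(with time reversed) or `Λ₂⁻¹`, the `W_n` are i.i.d., and `U` is bounded in probability. Hence
`T ^ n U_n → 0` in probability, the partial sums of `∑ T ^ n W_n` are Cauchy in probability, and
Ottaviani's inequality together with the second Borel-Cantelli lemma gives
`∑ ℙ(‖T ^ n W_0‖ > 1) < ∞` (`tsum_measure_pow_ne_top`). Since `‖T ^ (m + n) x‖ ≤ C r ^ m` whenever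
`‖T ^ n x‖ ≤ 1`, the first Borel-Cantelli lemma turns this into absolute convergence
(`ae_summable_norm_pow_apply`), with no moment condition and no invertibility of `A`. So every
solution is the series, and solutions are unique.

*Moment condition.* A logarithmic moment of `W_0` implies `∑ ℙ(‖T ^ n W_0‖ > 1) < ∞`, so that the
series converge and solve the equation, and they are stationary because the law of the noise is
invariant under shifts. Conversely, if `T` is bounded below, the summability implies the logarithmic
moment; this applies to `Λ₁` when `0 ∉ σ(A)`, and always to `Λ₂⁻¹`.
-/

noncomputable section

namespace ARMA

/-! ### Contour integrals of operator-valued functions -/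

section Contour

variable {F G : Type*} [NormedAddCommGroup F] [NormedSpace ℂ F]
  [NormedAddCommGroup G] [NormedSpace ℂ G]

theorem map_circleIntegral [CompleteSpace F] [CompleteSpace G] (L : F →L[ℂ] G) {f : ℂ → F}
    {c : ℂ} {R : ℝ} (hf : CircleIntegrable f c R) :
    ∮ z in C(c, R), L (f z) = L (∮ z in C(c, R), f z) := by
  simp only [circleIntegral]
  rw [← L.intervalIntegral_comp_comm hf.out]
  simp

/-- Fubini's theorem for two circles. -/
theorem circleIntegral_swap {f : ℂ → ℂ → F} {r s : ℝ} (hr : 0 ≤ r) (hs : 0 ≤ s)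
    (hf : ContinuousOn (Function.uncurry f) (Metric.sphere 0 r ×ˢ Metric.sphere 0 s)) :
    ∮ w in C(0, r), ∮ z in C(0, s), f w z = ∮ z in C(0, s), ∮ w in C(0, r), f w z := by
  simp only [circleIntegral, ← intervalIntegral.integral_smul]
  rw [MeasureTheory.intervalIntegral_intervalIntegral_swap]
  · refine intervalIntegral.integral_congr fun θ _ => ?_
    refine intervalIntegral.integral_congr fun φ _ => ?_
    exact smul_comm _ _ _
  · refine IntegrableOn.mono_set (t := Set.uIcc 0 (2 * π) ×ˢ Set.uIcc 0 (2 * π)) ?_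
      (Set.prod_mono Set.uIoc_subset_uIcc Set.uIoc_subset_uIcc)
    refine ContinuousOn.integrableOn_compact (isCompact_uIcc.prod isCompact_uIcc) ?_
    have h1 : Continuous fun p : ℝ × ℝ => f (circleMap 0 r p.1) (circleMap 0 s p.2) := by
      refine hf.comp_continuous (f := fun p : ℝ × ℝ => (circleMap 0 r p.1, circleMap 0 s p.2))
        (by fun_prop) fun p => ⟨circleMap_mem_sphere 0 hr _, circleMap_mem_sphere 0 hs _⟩
    have h2 : Continuous fun p : ℝ × ℝ => deriv (circleMap 0 r) p.1 := by
      simp only [deriv_circleMap]; fun_prop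
    have h3 : Continuous fun p : ℝ × ℝ => deriv (circleMap 0 s) p.2 := by
      simp only [deriv_circleMap]; fun_prop
    exact (h2.smul (h3.smul h1)).continuousOn

end Contour

/-! ### The Riesz projection -/

section Riesz

variable {E : Type*} [NormedAddCommGroup E] [NormedSpace ℂ E] {A : E →L[ℂ] E}

theorem sub_mul_resolvent {z : ℂ} (hz : z ∈ resolventSet ℂ A) :
    (algebraMap ℂ (E →L[ℂ] E) z - A) * resolvent A z = 1 :=
  Ring.mul_inverse_cancel _ hz

theorem resolvent_mul_sub {z : ℂ} (hz : z ∈ resolventSet ℂ A) :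
    resolvent A z * (algebraMap ℂ (E →L[ℂ] E) z - A) = 1 :=
  Ring.inverse_mul_cancel _ hz

theorem commute_resolvent {z : ℂ} (hz : z ∈ resolventSet ℂ A) : Commute A (resolvent A z) := by
  have h : Commute (algebraMap ℂ (E →L[ℂ] E) z - A) (resolvent A z) :=
    (sub_mul_resolvent hz).trans (resolvent_mul_sub hz).symm
  simpa using (Algebra.commute_algebraMap_left z (resolvent A z)).sub_left h

theorem mem_resolventSet_of_norm_eq_one (hA : spectrum ℂ A ∩ {z : ℂ | ‖z‖ = 1} = ∅) {z : ℂ}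
    (hz : ‖z‖ = 1) : z ∈ resolventSet ℂ A := by
  by_contra h
  exact (Set.ext_iff.1 hA z).1 ⟨h, hz⟩

/-- The Cauchy transform `(2πi)⁻¹ ∮ (w - z)⁻¹ (z - A)⁻¹ dz` of the resolvent over the unit circle.
Up to the sign it is the inverse of `w - A` on the range of one of the two complementary
projections. -/
def cauchyTransform (A : E →L[ℂ] E) (w : ℂ) : E →L[ℂ] E :=
  (2 * (π : ℂ) * Complex.I)⁻¹ • ∮ z in C(0, 1), (w - z)⁻¹ • resolvent A z

variable [CompleteSpace E]

theorem continuousOn_resolvent (A : E →L[ℂ] E) :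
    ContinuousOn (resolvent A) (resolventSet ℂ A) := fun _ hz =>
  (spectrum.hasDerivAt_resolvent_const_left hz).continuousAt.continuousWithinAt

theorem continuousOn_resolvent_sphere (hA : spectrum ℂ A ∩ {z : ℂ | ‖z‖ = 1} = ∅) :
    ContinuousOn (resolvent A) (Metric.sphere (0 : ℂ) 1) :=
  (continuousOn_resolvent A).mono fun z hz =>
    mem_resolventSet_of_norm_eq_one hA (by simpa using hz)

theorem continuousOn_sub_inv_smul_resolvent (hA : spectrum ℂ A ∩ {z : ℂ | ‖z‖ = 1} = ∅) {w : ℂ}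
    (hw : ‖w‖ ≠ 1) :
    ContinuousOn (fun z => (w - z)⁻¹ • resolvent A z) (Metric.sphere (0 : ℂ) 1) := by
  refine ContinuousOn.smul (ContinuousOn.inv₀ (f := fun z => w - z) (by fun_prop)
    fun z hz h => hw ?_) (continuousOn_resolvent_sphere hA)
  rw [sub_eq_zero.1 h]; simpa using hz

theorem circleIntegral_sub_inv_of_norm_lt {w : ℂ} {r : ℝ} (hw : ‖w‖ < r) :
    ∮ z in C(0, r), (w - z)⁻¹ = -(2 * π * Complex.I) := by
  rw [← circleIntegral.integral_sub_inv_of_mem_ball (c := 0) (R := r) (w := w) (by simpa using hw),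
    ← neg_one_mul, ← circleIntegral.integral_const_mul]
  congr 1; ext z
  rw [neg_one_mul, ← inv_neg, neg_sub]

theorem circleIntegral_sub_inv_of_lt_norm {w : ℂ} (hw : 1 < ‖w‖) :
    ∮ z in C(0, 1), (w - z)⁻¹ = 0 := by
  have hne : ∀ z ∈ Metric.closedBall (0 : ℂ) 1, w - z ≠ 0 := fun z hz h => by
    rw [sub_eq_zero.1 h] at hw
    simp at hz; linarith
  refine Complex.circleIntegral_eq_zero_of_differentiable_on_off_countable zero_le_one
    Set.countable_empty (ContinuousOn.inv₀ (by fun_prop) hne) fun z hz => ?_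
  exact DifferentiableAt.inv (by fun_prop) (hne z (Metric.ball_subset_closedBall hz.1))

/-- Write `w - A = (w - z) + (z - A)` under the integral sign. -/
theorem sub_mul_cauchyTransform (hA : spectrum ℂ A ∩ {z : ℂ | ‖z‖ = 1} = ∅) {w : ℂ}
    (hw : ‖w‖ ≠ 1) :
    (algebraMap ℂ (E →L[ℂ] E) w - A) * cauchyTransform A w =
      rieszProjection A + ((2 * (π : ℂ) * Complex.I)⁻¹ * ∮ z in C(0, 1), (w - z)⁻¹) • 1 := by
  have hint := (continuousOn_sub_inv_smul_resolvent hA hw).circleIntegrable zero_le_one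
  have h := map_circleIntegral
    (ContinuousLinearMap.mul ℂ (E →L[ℂ] E) (algebraMap ℂ (E →L[ℂ] E) w - A)) hint
  simp only [ContinuousLinearMap.mul_apply'] at h
  have hne : ∀ z ∈ Metric.sphere (0 : ℂ) 1, w - z ≠ 0 := fun z hz h => hw (by
    rw [sub_eq_zero.1 h]; simpa using hz)
  have hinv : ContinuousOn (fun z => (w - z)⁻¹) (Metric.sphere (0 : ℂ) 1) :=
    ContinuousOn.inv₀ (by fun_prop) hne
  rw [cauchyTransform, rieszProjection, mul_smul_comm, ← h, mul_smul, ← smul_add,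
    ← circleIntegral.integral_smul_const (fun z => (w - z)⁻¹) (1 : E →L[ℂ] E) 0 1,
    ← circleIntegral.integral_add
    ((continuousOn_resolvent_sphere hA).circleIntegrable zero_le_one)
    (ContinuousOn.circleIntegrable (f := fun z => (w - z)⁻¹ • (1 : E →L[ℂ] E)) zero_le_one
      (hinv.smul continuousOn_const))]
  congr 1
  refine circleIntegral.integral_congr zero_le_one fun z hz => ?_
  have h1 := sub_mul_resolvent (A := A)
    (mem_resolventSet_of_norm_eq_one hA (z := z) (by simpa using hz))
  have h2 : algebraMap ℂ (E →L[ℂ] E) w - A =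
      (w - z) • 1 + (algebraMap ℂ (E →L[ℂ] E) z - A) := by
    rw [Algebra.algebraMap_eq_smul_one, Algebra.algebraMap_eq_smul_one, sub_smul]; abel
  change (algebraMap ℂ (E →L[ℂ] E) w - A) * ((w - z)⁻¹ • resolvent A z) =
    resolvent A z + (w - z)⁻¹ • (1 : E →L[ℂ] E)
  rw [mul_smul_comm, h2, add_mul, h1, smul_mul_assoc, one_mul, smul_add, smul_smul,
    inv_mul_cancel₀ (hne z hz), one_smul]

theorem sub_mul_cauchyTransform_of_lt_norm (hA : spectrum ℂ A ∩ {z : ℂ | ‖z‖ = 1} = ∅) {w : ℂ}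
    (hw : 1 < ‖w‖) :
    (algebraMap ℂ (E →L[ℂ] E) w - A) * cauchyTransform A w = rieszProjection A := by
  rw [sub_mul_cauchyTransform hA hw.ne', circleIntegral_sub_inv_of_lt_norm hw]
  simp

theorem sub_mul_cauchyTransform_of_norm_lt (hA : spectrum ℂ A ∩ {z : ℂ | ‖z‖ = 1} = ∅) {w : ℂ}
    (hw : ‖w‖ < 1) :
    (algebraMap ℂ (E →L[ℂ] E) w - A) * cauchyTransform A w = rieszProjection A - 1 := by
  rw [sub_mul_cauchyTransform hA hw.ne, circleIntegral_sub_inv_of_norm_lt hw, mul_neg,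
    inv_mul_cancel₀ Complex.two_pi_I_ne_zero, neg_one_smul, sub_eq_add_neg]

theorem commute_rieszProjection (hA : spectrum ℂ A ∩ {z : ℂ | ‖z‖ = 1} = ∅) :
    Commute A (rieszProjection A) := by
  have hint := (continuousOn_resolvent_sphere hA).circleIntegrable zero_le_one
  have h1 := map_circleIntegral (ContinuousLinearMap.mul ℂ (E →L[ℂ] E) A) hint
  have h2 := map_circleIntegral ((ContinuousLinearMap.mul ℂ (E →L[ℂ] E)).flip A) hint
  simp only [ContinuousLinearMap.mul_apply', ContinuousLinearMap.flip_apply] at h1 h2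
  rw [Commute, SemiconjBy, rieszProjection, mul_smul_comm, smul_mul_assoc, ← h1, ← h2]
  congr 1
  refine circleIntegral.integral_congr zero_le_one fun z hz => ?_
  exact (commute_resolvent (mem_resolventSet_of_norm_eq_one hA (by simpa using hz))).eq

theorem commute_cauchyTransform (hA : spectrum ℂ A ∩ {z : ℂ | ‖z‖ = 1} = ∅) {w : ℂ}
    (hw : ‖w‖ ≠ 1) : Commute A (cauchyTransform A w) := by
  have hint := (continuousOn_sub_inv_smul_resolvent hA hw).circleIntegrable zero_le_one
  have h1 := map_circleIntegral (ContinuousLinearMap.mul ℂ (E →L[ℂ] E) A) hint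
  have h2 := map_circleIntegral ((ContinuousLinearMap.mul ℂ (E →L[ℂ] E)).flip A) hint
  simp only [ContinuousLinearMap.mul_apply', ContinuousLinearMap.flip_apply] at h1 h2
  rw [Commute, SemiconjBy, cauchyTransform, mul_smul_comm, smul_mul_assoc, ← h1, ← h2]
  congr 1
  refine circleIntegral.integral_congr zero_le_one fun z hz => ?_
  exact ((commute_resolvent
    (mem_resolventSet_of_norm_eq_one hA (by simpa using hz))).smul_right _).eq

/-- Since the spectrum is compact, a slightly larger circle has the same Riesz projection. -/
theorem exists_rieszProjection_eq_circleIntegral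
    (hA : spectrum ℂ A ∩ {z : ℂ | ‖z‖ = 1} = ∅) :
    ∃ r : ℝ, 1 < r ∧ (∀ z : ℂ, ‖z‖ = r → z ∈ resolventSet ℂ A) ∧
      rieszProjection A = (2 * (π : ℂ) * Complex.I)⁻¹ • ∮ z in C(0, r), resolvent A z := by
  obtain ⟨r, hr, hres⟩ : ∃ r : ℝ, 1 < r ∧
      ∀ z : ℂ, 1 ≤ ‖z‖ → ‖z‖ ≤ r → z ∈ resolventSet ℂ A := by
    have hK : IsCompact (spectrum ℂ A ∩ {z : ℂ | 1 ≤ ‖z‖}) :=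
      (spectrum.isCompact A).inter_right (isClosed_le continuous_const continuous_norm)
    rcases (spectrum ℂ A ∩ {z : ℂ | 1 ≤ ‖z‖}).eq_empty_or_nonempty with h | h
    · refine ⟨2, one_lt_two, fun z hz _ => ?_⟩
      by_contra hn
      exact (Set.ext_iff.1 h z).1 ⟨hn, hz⟩
    · obtain ⟨z₀, hz₀, hmin⟩ := hK.exists_isMinOn h continuous_norm.continuousOn
      have h1 : 1 < ‖z₀‖ := lt_of_le_of_ne hz₀.2 fun he =>
        (Set.ext_iff.1 hA z₀).1 ⟨hz₀.1, he.symm⟩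
      refine ⟨(1 + ‖z₀‖) / 2, by linarith, fun z hz hz' => ?_⟩
      by_contra hn
      have : ‖z₀‖ ≤ ‖z‖ := hmin (a := z) ⟨hn, hz⟩
      linarith
  refine ⟨r, hr, fun z hz => hres z (by linarith) hz.le, ?_⟩
  rw [rieszProjection, Complex.circleIntegral_eq_of_differentiable_on_annulus_off_countable
    zero_lt_one hr.le Set.countable_empty]
  · refine (continuousOn_resolvent A).mono fun z hz => hres z ?_ ?_
    · simpa using hz.2
    · simpa using hz.1
  · intro z hz
    refine (spectrum.hasDerivAt_resolvent_const_left (hres z ?_ ?_)).differentiableAt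
    · exact le_of_lt (by simpa using hz.1.2)
    · exact le_of_lt (by simpa using hz.1.1)

/-- Integrate `(w - A)⁻¹ P` over a slightly larger circle `|w| = r`, on which it is the Cauchy
transform of the resolvent. After Fubini the inner integral `∮ (w - z)⁻¹ dw` is `2πi`, because
`|z| = 1 < r`. -/
theorem isIdempotentElem_rieszProjection (hA : spectrum ℂ A ∩ {z : ℂ | ‖z‖ = 1} = ∅) :
    IsIdempotentElem (rieszProjection A) := by
  obtain ⟨r, hr, hres, hP⟩ := exists_rieszProjection_eq_circleIntegral hA
  have hr0 : 0 ≤ r := by linarith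
  have hint : CircleIntegrable (resolvent A) 0 r :=
    ((continuousOn_resolvent A).mono fun z hz => hres z (by simpa using hz)).circleIntegrable hr0
  have h1 := map_circleIntegral
    ((ContinuousLinearMap.mul ℂ (E →L[ℂ] E)).flip (rieszProjection A)) hint
  simp only [ContinuousLinearMap.mul_apply', ContinuousLinearMap.flip_apply] at h1
  -- on the larger circle `(w - A)⁻¹ P` is the Cauchy transform
  have h2 : ∮ w in C(0, r), resolvent A w * rieszProjection A =
      ∮ w in C(0, r), (2 * (π : ℂ) * Complex.I)⁻¹ •
        ∮ z in C(0, 1), (w - z)⁻¹ • resolvent A z := by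
    refine circleIntegral.integral_congr hr0 fun w hw => ?_
    have hw' : ‖w‖ = r := by simpa using hw
    change resolvent A w * rieszProjection A = cauchyTransform A w
    rw [← sub_mul_cauchyTransform_of_lt_norm hA (hw'.symm ▸ hr : 1 < ‖w‖), ← mul_assoc,
      resolvent_mul_sub (hres w hw'), one_mul]
  have h3 : ∮ w in C(0, r), ∮ z in C(0, 1), (w - z)⁻¹ • resolvent A z =
      ∮ z in C(0, 1), (2 * (π : ℂ) * Complex.I) • resolvent A z := by
    rw [circleIntegral_swap hr0 zero_le_one]
    · refine circleIntegral.integral_congr zero_le_one fun z hz => ?_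
      have hz' : ‖z‖ < r := by
        have : ‖z‖ = 1 := by simpa using hz
        linarith
      change ∮ w in C(0, r), (w - z)⁻¹ • resolvent A z = _
      rw [circleIntegral.integral_smul_const,
        circleIntegral.integral_sub_inv_of_mem_ball (by simpa using hz')]
    · refine ContinuousOn.smul (ContinuousOn.inv₀ (f := fun p : ℂ × ℂ => p.1 - p.2) (by fun_prop)
        fun p hp h => ?_) ?_
      · have e1 : ‖p.1‖ = r := by simpa using hp.1
        have e2 : ‖p.2‖ = 1 := by simpa using hp.2
        rw [sub_eq_zero.1 h] at e1
        linarith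
      · exact (continuousOn_resolvent_sphere hA).comp continuousOn_snd fun p hp => hp.2
  rw [IsIdempotentElem]
  nth_rw 1 [hP]
  rw [smul_mul_assoc, ← h1, h2, circleIntegral.integral_smul, h3, circleIntegral.integral_smul,
    smul_smul, smul_smul, mul_assoc, inv_mul_cancel₀ Complex.two_pi_I_ne_zero, mul_one,
    rieszProjection]

end Riesz

/-! ### Compression of an operator to a complemented subspace -/

section Compression

variable {E : Type*} [NormedAddCommGroup E] [NormedSpace ℂ E] {A P T : E →L[ℂ] E}

/-- The compression `P X|` of an operator `X` to the range of `P`. The diagonal entries `Λ₁` and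
`Λ₂` are the compressions of `A` for the Riesz projection and its complement. -/
def compress (P X : E →L[ℂ] E) :
    LinearMap.range P.toLinearMap →L[ℂ] LinearMap.range P.toLinearMap :=
  P.codRestrict (LinearMap.range P.toLinearMap) (fun x => ⟨x, rfl⟩) ∘L X ∘L
    (LinearMap.range P.toLinearMap).subtypeL

@[simp]
theorem coe_compress_apply (P X : E →L[ℂ] E) (v : LinearMap.range P.toLinearMap) :
    (compress P X v : E) = P (X v) := rfl

theorem apply_eq_self_of_mem_range (hP : IsIdempotentElem P)
    (v : LinearMap.range P.toLinearMap) : P v = v := by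
  obtain ⟨_, x, rfl⟩ := v
  exact DFunLike.congr_fun hP.eq x

theorem apply_apply_of_isIdempotentElem (hP : IsIdempotentElem P) (x : E) : P (P x) = P x :=
  DFunLike.congr_fun hP.eq x

theorem commute_apply {X Y : E →L[ℂ] E} (h : Commute X Y) (x : E) : X (Y x) = Y (X x) :=
  DFunLike.congr_fun h.eq x

theorem coe_compress_apply_of_commute (hP : IsIdempotentElem P) (h : Commute A P)
    (v : LinearMap.range P.toLinearMap) : (compress P A v : E) = A v := by
  rw [coe_compress_apply, ← commute_apply h, apply_eq_self_of_mem_range hP]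

theorem completeSpace_range [CompleteSpace E] (hP : IsIdempotentElem P) :
    CompleteSpace (LinearMap.range P.toLinearMap) := by
  have h : IsClosed (LinearMap.range P.toLinearMap : Set E) := by
    have : (LinearMap.range P.toLinearMap : Set E) = {x | P x = x} := by
      ext x
      exact ⟨fun hx => apply_eq_self_of_mem_range hP ⟨x, hx⟩, fun hx => ⟨x, hx⟩⟩
    rw [this]
    exact isClosed_eq P.continuous continuous_id
  exact h.completeSpace_coe

theorem compress_mul_of_commute_left (hP : IsIdempotentElem P) {X Y : E →L[ℂ] E}
    (h : Commute X P) : compress P (X * Y) = compress P X * compress P Y := by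
  ext v
  change P (X (Y v)) = P (X (P (Y v)))
  rw [commute_apply h, apply_apply_of_isIdempotentElem hP]

theorem compress_mul_of_commute_right (hP : IsIdempotentElem P) {X Y : E →L[ℂ] E}
    (h : Commute Y P) : compress P (X * Y) = compress P X * compress P Y := by
  ext v
  change P (X (Y v)) = P (X (P (Y v)))
  rw [← commute_apply h, apply_eq_self_of_mem_range hP]

theorem compress_self (hP : IsIdempotentElem P) : compress P P = 1 := by
  ext v
  change P (P v) = v
  simp only [apply_eq_self_of_mem_range hP]

theorem compress_algebraMap_sub (hP : IsIdempotentElem P) (w : ℂ) :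
    compress P (algebraMap ℂ (E →L[ℂ] E) w - A) = algebraMap ℂ _ w - compress P A := by
  ext v
  change P (w • (v : E) - A v) = w • (v : E) - P (A v)
  rw [map_sub, map_smul, apply_eq_self_of_mem_range hP]

/-- If `(w - A) T = P` with `T` commuting with `A`, then the compression of `T` inverts that of
`w - A`; `T` itself need not commute with `P`. -/
theorem mem_resolventSet_compress (hP : IsIdempotentElem P) (hAP : Commute A P)
    (hAT : Commute A T) {w : ℂ} (h : (algebraMap ℂ (E →L[ℂ] E) w - A) * T = P) :
    w ∈ resolventSet ℂ (compress P A) := by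
  have h' : T * (algebraMap ℂ (E →L[ℂ] E) w - A) = P := by
    rw [← h]
    exact ((Algebra.commute_algebraMap_right w T).sub_right hAT.symm).eq
  have hc : Commute (algebraMap ℂ (E →L[ℂ] E) w - A) P :=
    (Algebra.commute_algebraMap_left w P).sub_left hAP
  refine spectrum.mem_resolventSet_of_left_right_inverse (b := compress P T)
    (c := compress P T) ?_ ?_
  · rw [← compress_algebraMap_sub hP, ← compress_mul_of_commute_left hP hc, h, compress_self hP]
  · rw [← compress_algebraMap_sub hP, ← compress_mul_of_commute_right hP hc, h', compress_self hP]

theorem mem_resolventSet_compress_of_mem (hP : IsIdempotentElem P) (hAP : Commute A P) {w : ℂ}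
    (h : w ∈ resolventSet ℂ A) : w ∈ resolventSet ℂ (compress P A) :=
  mem_resolventSet_compress hP hAP (T := resolvent A w * P)
    ((commute_resolvent h).mul_right hAP) (by rw [← mul_assoc, sub_mul_resolvent h, one_mul])

/-- The inclusion of the range of `P` composed with `X` and the corestriction of `P`. -/
def extend (P : E →L[ℂ] E)
    (X : LinearMap.range P.toLinearMap →L[ℂ] LinearMap.range P.toLinearMap) : E →L[ℂ] E :=
  (LinearMap.range P.toLinearMap).subtypeL ∘L X ∘L
    P.codRestrict (LinearMap.range P.toLinearMap) (fun x => ⟨x, rfl⟩)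

theorem sub_mul_extend (hP : IsIdempotentElem P) (hAP : Commute A P) {w : ℂ}
    (h : w ∈ resolventSet ℂ (compress P A)) :
    (algebraMap ℂ (E →L[ℂ] E) w - A) * extend P (Ring.inverse (algebraMap ℂ _ w - compress P A))
      = P := by
  ext x
  set R := Ring.inverse (algebraMap ℂ _ w - compress P A)
  set v : LinearMap.range P.toLinearMap := ⟨P x, x, rfl⟩ with hv
  change w • (R v : E) - A (R v) = v
  have h1 := congrArg Subtype.val (DFunLike.congr_fun (Ring.mul_inverse_cancel _ h) v)
  change w • (R v : E) - compress P A (R v) = v at h1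
  rwa [coe_compress_apply_of_commute hP hAP] at h1

theorem extend_mul_sub (hP : IsIdempotentElem P) (hAP : Commute A P) {w : ℂ}
    (h : w ∈ resolventSet ℂ (compress P A)) :
    extend P (Ring.inverse (algebraMap ℂ _ w - compress P A)) * (algebraMap ℂ (E →L[ℂ] E) w - A)
      = P := by
  ext x
  set R := Ring.inverse (algebraMap ℂ _ w - compress P A)
  set v : LinearMap.range P.toLinearMap := ⟨P x, x, rfl⟩ with hv
  change (R ⟨P (w • x - A x), _, rfl⟩ : E) = v
  have h1 := congrArg Subtype.val (DFunLike.congr_fun (Ring.inverse_mul_cancel _ h) v)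
  change (R (w • v - compress P A v) : E) = v at h1
  rw [← h1]
  congr 2
  ext
  change P (w • x - A x) = w • P x - P (A (P x))
  rw [map_sub, map_smul, commute_apply hAP, apply_apply_of_isIdempotentElem hP]

theorem mem_resolventSet_of_compress (hP : IsIdempotentElem P) (hAP : Commute A P) {w : ℂ}
    (h₁ : w ∈ resolventSet ℂ (compress P A)) (h₂ : w ∈ resolventSet ℂ (compress (1 - P) A)) :
    w ∈ resolventSet ℂ A := by
  have hAQ : Commute A (1 - P) := (Commute.one_right A).sub_right hAP
  refine spectrum.mem_resolventSet_of_left_right_inverse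
    (b := extend P (Ring.inverse (algebraMap ℂ _ w - compress P A)) +
      extend (1 - P) (Ring.inverse (algebraMap ℂ _ w - compress (1 - P) A)))
    (c := extend P (Ring.inverse (algebraMap ℂ _ w - compress P A)) +
      extend (1 - P) (Ring.inverse (algebraMap ℂ _ w - compress (1 - P) A))) ?_ ?_
  · rw [mul_add, sub_mul_extend hP hAP h₁, sub_mul_extend hP.one_sub hAQ h₂, add_sub_cancel]
  · rw [add_mul, extend_mul_sub hP hAP h₁, extend_mul_sub hP.one_sub hAQ h₂, add_sub_cancel]

end Compression

/-! ### The splitting and its spectra -/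

section Splitting

variable {E : Type*} [NormedAddCommGroup E] [NormedSpace ℂ E] {A : E →L[ℂ] E}

theorem splitMap_comp_splitInv (A : E →L[ℂ] E) :
    splitMap A ∘L splitInv A = ContinuousLinearMap.id ℂ E := by
  ext x
  change rieszProjection A x + (x - rieszProjection A x) = x
  abel

variable [CompleteSpace E]

theorem spectrum_stableOp (hA : spectrum ℂ A ∩ {z : ℂ | ‖z‖ = 1} = ∅) :
    spectrum ℂ (stableOp A) = {z : ℂ | ‖z‖ < 1} ∩ spectrum ℂ A := by
  have hP := isIdempotentElem_rieszProjection hA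
  have hAP := commute_rieszProjection hA
  ext w
  refine ⟨fun hw => ?_, fun ⟨hw1, hw⟩ h1 => hw ?_⟩
  · have hwA : w ∈ spectrum ℂ A := fun h => hw (mem_resolventSet_compress_of_mem hP hAP h)
    refine ⟨?_, hwA⟩
    rcases lt_trichotomy ‖w‖ 1 with h | h | h
    · exact h
    · exact absurd (mem_resolventSet_of_norm_eq_one hA h) hwA
    · exact absurd (mem_resolventSet_compress hP hAP (commute_cauchyTransform hA h.ne')
        (sub_mul_cauchyTransform_of_lt_norm hA h)) hw
  · refine mem_resolventSet_of_compress hP hAP h1 ?_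
    refine mem_resolventSet_compress (T := -cauchyTransform A w) hP.one_sub
      ((Commute.one_right A).sub_right hAP)
      (commute_cauchyTransform hA (ne_of_lt hw1)).neg_right ?_
    rw [mul_neg, sub_mul_cauchyTransform_of_norm_lt hA hw1, neg_sub]

theorem spectrum_unstableOp (hA : spectrum ℂ A ∩ {z : ℂ | ‖z‖ = 1} = ∅) :
    spectrum ℂ (unstableOp A) = {z : ℂ | 1 < ‖z‖} ∩ spectrum ℂ A := by
  have hP := isIdempotentElem_rieszProjection hA
  have hAP := commute_rieszProjection hA
  have hAQ : Commute A (1 - rieszProjection A) := (Commute.one_right A).sub_right hAP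
  ext w
  refine ⟨fun hw => ?_, fun ⟨hw1, hw⟩ h1 => hw ?_⟩
  · have hwA : w ∈ spectrum ℂ A := fun h => hw (mem_resolventSet_compress_of_mem hP.one_sub hAQ h)
    refine ⟨?_, hwA⟩
    rcases lt_trichotomy ‖w‖ 1 with h | h | h
    · refine absurd (mem_resolventSet_compress (T := -cauchyTransform A w) hP.one_sub hAQ
        (commute_cauchyTransform hA h.ne).neg_right ?_) hw
      rw [mul_neg, sub_mul_cauchyTransform_of_norm_lt hA h, neg_sub]
    · exact absurd (mem_resolventSet_of_norm_eq_one hA h) hwA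
    · exact h
  · exact mem_resolventSet_of_compress hP hAP (mem_resolventSet_compress hP hAP
      (commute_cauchyTransform hA (ne_of_gt hw1)) (sub_mul_cauchyTransform_of_lt_norm hA hw1)) h1

theorem splitInv_comp_splitMap (hA : spectrum ℂ A ∩ {z : ℂ | ‖z‖ = 1} = ∅) :
    splitInv A ∘L splitMap A = ContinuousLinearMap.id ℂ (stableSpace A × unstableSpace A) := by
  have hP := isIdempotentElem_rieszProjection hA
  refine ContinuousLinearMap.ext fun ⟨v, u⟩ => ?_
  have hv : rieszProjection A v = v := apply_eq_self_of_mem_range hP v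
  have hu : (u : E) - rieszProjection A u = u := apply_eq_self_of_mem_range hP.one_sub u
  have hu0 : rieszProjection A u = 0 := by simpa using hu
  refine Prod.ext (Subtype.ext ?_) (Subtype.ext ?_)
  · change rieszProjection A (v + u) = v
    rw [map_add, hv, hu0, add_zero]
  · change ((v : E) + u) - rieszProjection A (v + u) = u
    rw [map_add, hv, hu0, add_zero, add_sub_cancel_left]

theorem stablePart_apply_map (hA : spectrum ℂ A ∩ {z : ℂ | ‖z‖ = 1} = ∅) (x : E) :
    stablePart A (A x) = stableOp A (stablePart A x) := by
  have hP := isIdempotentElem_rieszProjection hA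
  have hAP := commute_rieszProjection hA
  ext
  change rieszProjection A (A x) = rieszProjection A (A (rieszProjection A x))
  rw [commute_apply hAP, apply_apply_of_isIdempotentElem hP]

theorem unstablePart_apply_map (hA : spectrum ℂ A ∩ {z : ℂ | ‖z‖ = 1} = ∅) (x : E) :
    unstablePart A (A x) = unstableOp A (unstablePart A x) := by
  have hP := (isIdempotentElem_rieszProjection hA).one_sub
  have hAP : Commute A (1 - rieszProjection A) :=
    (Commute.one_right A).sub_right (commute_rieszProjection hA)
  ext
  change (1 - rieszProjection A) (A x) =
    (1 - rieszProjection A) (A ((1 - rieszProjection A) x))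
  rw [commute_apply hAP, apply_apply_of_isIdempotentElem hP]

theorem splitInv_comp_comp_splitMap (hA : spectrum ℂ A ∩ {z : ℂ | ‖z‖ = 1} = ∅) :
    splitInv A ∘L A ∘L splitMap A = (stableOp A).prodMap (unstableOp A) := by
  refine ContinuousLinearMap.ext fun x => ?_
  have h := DFunLike.congr_fun (splitInv_comp_splitMap hA) x
  have h1 : stablePart A (splitMap A x) = x.1 := congrArg Prod.fst h
  have h2 : unstablePart A (splitMap A x) = x.2 := congrArg Prod.snd h
  change (stablePart A (A (splitMap A x)), unstablePart A (A (splitMap A x))) =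
    (stableOp A x.1, unstableOp A x.2)
  rw [stablePart_apply_map hA, unstablePart_apply_map hA, h1, h2]

theorem completeSpace_stableSpace (hA : spectrum ℂ A ∩ {z : ℂ | ‖z‖ = 1} = ∅) :
    CompleteSpace (stableSpace A) :=
  completeSpace_range (isIdempotentElem_rieszProjection hA)

theorem completeSpace_unstableSpace (hA : spectrum ℂ A ∩ {z : ℂ | ‖z‖ = 1} = ∅) :
    CompleteSpace (unstableSpace A) :=
  completeSpace_range (isIdempotentElem_rieszProjection hA).one_sub

theorem isUnit_unstableOp (hA : spectrum ℂ A ∩ {z : ℂ | ‖z‖ = 1} = ∅) :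
    IsUnit (unstableOp A) := by
  rw [← spectrum.zero_notMem_iff ℂ, spectrum_unstableOp hA]
  exact fun h => absurd h.1 (by simp)

theorem norm_lt_one_of_mem_spectrum_inverse_unstableOp
    (hA : spectrum ℂ A ∩ {z : ℂ | ‖z‖ = 1} = ∅) :
    ∀ z ∈ spectrum ℂ (Ring.inverse (unstableOp A)), ‖z‖ < 1 := by
  intro z hz
  obtain ⟨u, hu⟩ := isUnit_unstableOp hA
  rw [← hu, Ring.inverse_unit, ← spectrum.map_inv, hu, spectrum_unstableOp hA] at hz
  have h : 1 < ‖z⁻¹‖ := hz.1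
  rw [norm_inv] at h
  exact (one_lt_inv_iff₀.1 h).2

end Splitting

/-! ### Geometric decay of powers -/

section Decay

variable {F : Type*} [NormedAddCommGroup F] [NormedSpace ℂ F]

/-- The powers of `T` decay geometrically in operator norm. -/
def IsPowerContracting (T : F →L[ℂ] F) : Prop :=
  ∃ C r : ℝ, 0 < C ∧ 0 < r ∧ r < 1 ∧ ∀ n : ℕ, ‖T ^ n‖ ≤ C * r ^ n

/-- By Gelfand's formula; the trivial space is treated apart because its operators have empty
spectrum. -/
theorem isPowerContracting_of_spectrum [CompleteSpace F] (T : F →L[ℂ] F)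
    (hT : ∀ z ∈ spectrum ℂ T, ‖z‖ < 1) : IsPowerContracting T := by
  rcases subsingleton_or_nontrivial F with hF | hF
  · refine ⟨1, 1 / 2, one_pos, by norm_num, by norm_num, fun n => ?_⟩
    rw [Subsingleton.elim (T ^ n) 0, norm_zero]
    positivity
  have hlt : spectralRadius ℂ T < (1 : NNReal) :=
    spectrum.spectralRadius_lt_of_forall_lt T fun z hz => by
      rw [← NNReal.coe_lt_coe]; simpa using hT z hz
  obtain ⟨r, hr, hr1⟩ := ENNReal.lt_iff_exists_nnreal_btwn.1 hlt
  have hr0 : 0 < r := by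
    rw [← ENNReal.coe_pos]; exact hr.bot_lt
  have hev : ∀ᶠ n : ℕ in Filter.atTop, ‖T ^ n‖ ≤ 1 * ‖(r : ℝ) ^ n‖ := by
    filter_upwards [
      (spectrum.pow_nnnorm_pow_one_div_tendsto_nhds_spectralRadius T).eventually_lt_const hr,
      Filter.eventually_gt_atTop 0] with n hn hn0
    have h1 : (‖T ^ n‖₊ : ENNReal) < (r : ENNReal) ^ (n : ℝ) := by
      have := ENNReal.rpow_lt_rpow hn (z := (n : ℝ)) (by positivity)
      rwa [← ENNReal.rpow_mul, one_div_mul_cancel (by positivity), ENNReal.rpow_one] at this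
    rw [ENNReal.rpow_natCast, ← ENNReal.coe_pow, ENNReal.coe_lt_coe, ← NNReal.coe_lt_coe] at h1
    simpa using h1.le
  obtain ⟨C, hC, h⟩ := Asymptotics.bound_of_isBigO_nat_atTop (Asymptotics.IsBigO.of_bound 1 hev)
  refine ⟨C, r, hC, by exact_mod_cast hr0, by exact_mod_cast hr1, fun n => ?_⟩
  have := h (x := n) (by positivity)
  simpa using this

end Decay

/-! ### A maximal inequality for sums of independent random variables -/

section Maximal

open Filter Topology
open scoped ENNReal

variable {Ω F : Type*} [NormedAddCommGroup F] [MeasurableSpace F] [BorelSpace F]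

theorem measurableSet_norm_sum_gt [SecondCountableTopology F] {ι : Type*} {_ : MeasurableSpace Ω}
    {ξ : ι → Ω → F} {t : Finset ι} {c : ℝ} (h : ∀ i ∈ t, Measurable (ξ i)) :
    MeasurableSet {ω | c < ‖∑ i ∈ t, ξ i ω‖} :=
  measurableSet_lt measurable_const (Finset.measurable_fun_sum t h).norm

theorem iIndepSet_norm_gt [MeasurableSpace Ω] {μ : Measure Ω} {ξ : ℕ → Ω → F}
    (hi : iIndepFun ξ μ) (hm : ∀ i, Measurable (ξ i))
    (c : ℝ) : iIndepSet (fun k => {ω | c < ‖ξ k ω‖}) μ := by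
  have hset : MeasurableSet {x : F | c < ‖x‖} := measurableSet_lt measurable_const measurable_norm
  refine (iIndepSet_iff_meas_biInter fun k => hm k hset).2 fun t => ?_
  exact hi.meas_biInter fun i _ => ⟨{x : F | c < ‖x‖}, hset, rfl⟩

variable [MeasurableSpace Ω] {μ : Measure Ω} [IsProbabilityMeasure μ] [SecondCountableTopology F]

/-- Ottaviani's inequality, with fixed constants. On the event that `‖S k‖` exceeds `2ε` for the
first time, independence leaves `‖S n‖ > ε` with conditional probability at least `1/2`. -/
theorem measure_iUnion_norm_sum_gt_le {ξ : ℕ → Ω → F} (hm : ∀ i, Measurable (ξ i))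
    (hi : iIndepFun ξ μ) {ε : ℝ}
    (h : ∀ m n, m ≤ n → μ {ω | ε < ‖∑ i ∈ Finset.Ico m n, ξ i ω‖} ≤ 4⁻¹) :
    μ (⋃ k, {ω | 2 * ε < ‖∑ i ∈ Finset.range k, ξ i ω‖}) ≤ 2⁻¹ := by
  set s : ℕ → Set Ω := fun k => {ω | 2 * ε < ‖∑ i ∈ Finset.range k, ξ i ω‖} with hs
  set a : ℕ → Set Ω := fun k => s k ∩ ⋂ j ∈ Finset.range k, (s j)ᶜ with ha
  have hmeas : ∀ (S : Set ℕ) (t : Finset ℕ) (c : ℝ), (∀ i ∈ t, i ∈ S) →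
      MeasurableSet[⨆ i ∈ S, MeasurableSpace.comap (ξ i) inferInstance]
        {ω | c < ‖∑ i ∈ t, ξ i ω‖} := by
    intro S t c hS
    refine measurableSet_norm_sum_gt fun i hit => ?_
    exact (comap_measurable (ξ i)).mono
      (le_iSup₂_of_le (f := fun i (_ : i ∈ S) => MeasurableSpace.comap (ξ i) inferInstance)
        i (hS i hit) le_rfl) le_rfl
  have hle : ∀ S : Set ℕ, (⨆ i ∈ S, MeasurableSpace.comap (ξ i) inferInstance) ≤
      (inferInstance : MeasurableSpace Ω) := fun S => iSup₂_le fun i _ => (hm i).comap_le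
  have ha_meas : ∀ k, MeasurableSet[⨆ i ∈ Set.Iio k, MeasurableSpace.comap (ξ i) inferInstance]
      (a k) := by
    intro k
    refine @MeasurableSet.inter _ (_) _ _ (hmeas _ _ _ fun i hi => by simpa using hi) ?_
    refine @Finset.measurableSet_biInter _ _ (_) _ _ fun j hj => ?_
    refine @MeasurableSet.compl _ _ (_) (hmeas _ _ _ fun i hi => ?_)
    simp at hi hj ⊢; omega
  have ha_meas' : ∀ k, MeasurableSet (a k) := fun k => hle _ _ (ha_meas k)
  have hdisj : ∀ j k, j < k → Disjoint (a j) (a k) := by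
    intro j k hjk
    refine Set.disjoint_left.2 fun ω h1 h2 => ?_
    have := Set.mem_iInter₂.1 h2.2 j (Finset.mem_range.2 hjk)
    exact this h1.1
  have hpair : Pairwise (Function.onFun Disjoint a) := by
    intro j k hjk
    rcases hjk.lt_or_gt with h | h
    · exact hdisj j k h
    · exact (hdisj k j h).symm
  have hunion : (⋃ k, s k) ⊆ ⋃ k, a k := by
    intro ω hω
    obtain ⟨k, hk⟩ := Set.mem_iUnion.1 hω
    classical
    have hex : ∃ k, ω ∈ s k := ⟨k, hk⟩
    refine Set.mem_iUnion.2 ⟨Nat.find hex, Nat.find_spec hex, ?_⟩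
    exact Set.mem_iInter₂.2 fun j hj => Nat.find_min hex (Finset.mem_range.1 hj)
  have hstep : ∀ k n, k ≤ n →
      μ (a k) * 2⁻¹ ≤ μ (a k ∩ {ω | ε < ‖∑ i ∈ Finset.range n, ξ i ω‖}) := by
    intro k n hkn
    set g : Set Ω := {ω | ε < ‖∑ i ∈ Finset.Ico k n, ξ i ω‖} with hg
    have hgm : MeasurableSet[⨆ i ∈ Set.Ici k, MeasurableSpace.comap (ξ i) inferInstance] g :=
      hmeas _ _ _ fun i hi => (Finset.mem_Ico.1 hi).1
    have hind : Indep (⨆ i ∈ Set.Iio k, MeasurableSpace.comap (ξ i) inferInstance)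
        (⨆ i ∈ Set.Ici k, MeasurableSpace.comap (ξ i) inferInstance) μ :=
      indep_iSup_of_disjoint (fun i => (hm i).comap_le) hi
        (Set.disjoint_left.2 fun i h1 h2 => not_lt.2 (Set.mem_Ici.1 h2) (Set.mem_Iio.1 h1))
    have hprod : μ (a k ∩ gᶜ) = μ (a k) * μ gᶜ :=
      (Indep_iff _ _ _).1 hind _ _ (ha_meas k) (@MeasurableSet.compl _ _ (_) hgm)
    have hgc : 2⁻¹ ≤ μ gᶜ := by
      rw [prob_compl_eq_one_sub (hle _ _ hgm)]
      calc (2⁻¹ : ℝ≥0∞) = 1 - 2⁻¹ := by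
            rw [ENNReal.one_sub_inv_two]
        _ ≤ 1 - μ g := by
            refine tsub_le_tsub_left ((h k n hkn).trans ?_) 1
            exact ENNReal.inv_le_inv.2 (by norm_num)
    calc μ (a k) * 2⁻¹ ≤ μ (a k) * μ gᶜ := by gcongr
      _ = μ (a k ∩ gᶜ) := hprod.symm
      _ ≤ _ := by
        refine measure_mono fun ω hω => ⟨hω.1, ?_⟩
        have h1 : 2 * ε < ‖∑ i ∈ Finset.range k, ξ i ω‖ := hω.1.1
        have h2 : ‖∑ i ∈ Finset.Ico k n, ξ i ω‖ ≤ ε := not_lt.1 hω.2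
        have h3 := Finset.sum_range_add_sum_Ico (fun i => ξ i ω) hkn
        have h4 := norm_sub_le (∑ i ∈ Finset.range n, ξ i ω) (∑ i ∈ Finset.Ico k n, ξ i ω)
        rw [← h3, add_sub_cancel_right] at h4
        change ε < ‖∑ i ∈ Finset.range n, ξ i ω‖
        rw [← h3]
        linarith
  have hfin : ∀ n, ∑ k ∈ Finset.range n, μ (a k) * 2⁻¹ ≤ 4⁻¹ := by
    intro n
    calc ∑ k ∈ Finset.range n, μ (a k) * 2⁻¹
        ≤ ∑ k ∈ Finset.range n, μ (a k ∩ {ω | ε < ‖∑ i ∈ Finset.range n, ξ i ω‖}) :=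
          Finset.sum_le_sum fun k hk => hstep k n (Finset.mem_range.1 hk).le
      _ = μ (⋃ k ∈ Finset.range n, a k ∩ {ω | ε < ‖∑ i ∈ Finset.range n, ξ i ω‖}) := by
          refine (measure_biUnion_finset ?_ fun k _ => ?_).symm
          · intro j _ k _ hjk
            exact (hpair hjk).mono Set.inter_subset_left Set.inter_subset_left
          · exact (ha_meas' k).inter (hle _ _ (hmeas Set.univ _ _ fun i _ => Set.mem_univ i))
      _ ≤ μ {ω | ε < ‖∑ i ∈ Finset.Ico 0 n, ξ i ω‖} := by
          rw [← Finset.range_eq_Ico]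
          exact measure_mono (Set.iUnion₂_subset fun k _ => Set.inter_subset_right)
      _ ≤ 4⁻¹ := h 0 n (Nat.zero_le n)
  have htsum : (∑' k, μ (a k)) * 2⁻¹ ≤ 4⁻¹ := by
    rw [← ENNReal.tsum_mul_right]
    exact ENNReal.tsum_le_of_sum_range_le hfin
  calc μ (⋃ k, s k) ≤ μ (⋃ k, a k) := measure_mono hunion
    _ ≤ ∑' k, μ (a k) := measure_iUnion_le a
    _ = (∑' k, μ (a k)) * 2⁻¹ * 2 := by
        rw [mul_assoc, ENNReal.inv_mul_cancel two_ne_zero ENNReal.ofNat_ne_top, mul_one]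
    _ ≤ 4⁻¹ * 2 := by gcongr
    _ = 2⁻¹ := by
        rw [show (4 : ℝ≥0∞) = 2 * 2 by norm_num,
          ENNReal.mul_inv (Or.inl two_ne_zero) (Or.inl ENNReal.ofNat_ne_top), mul_assoc,
          ENNReal.inv_mul_cancel two_ne_zero ENNReal.ofNat_ne_top, mul_one]

/-- If the tail sums of independent variables are small in probability, then the probabilities of
large single terms are summable. -/
theorem tsum_measure_norm_gt_ne_top {ξ : ℕ → Ω → F} (hm : ∀ i, Measurable (ξ i))
    (hi : iIndepFun ξ μ) {ε : ℝ} {N : ℕ}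
    (h : ∀ m n, N ≤ m → m ≤ n → μ {ω | ε < ‖∑ i ∈ Finset.Ico m n, ξ i ω‖} ≤ 4⁻¹) :
    ∑' k, μ {ω | 4 * ε < ‖ξ k ω‖} ≠ ⊤ := by
  intro htop
  have hmeas : ∀ k, MeasurableSet {ω | 4 * ε < ‖ξ k ω‖} := fun k =>
    measurableSet_lt measurable_const (hm k).norm
  have h1 := measure_limsup_eq_one hmeas (iIndepSet_norm_gt hi hm _) htop
  have h2 := measure_iUnion_norm_sum_gt_le (ξ := fun i => ξ (N + i)) (fun i => hm _)
    (hi.precomp (add_right_injective N)) (ε := ε) fun m n hmn => by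
      have e : ∀ ω, ∑ i ∈ Finset.Ico m n, ξ (N + i) ω =
          ∑ i ∈ Finset.Ico (m + N) (n + N), ξ i ω :=
        fun ω => Finset.sum_Ico_add (fun i => ξ i ω) m n N
      simp only [e]
      exact h (m + N) (n + N) (by omega) (by omega)
  have h3 : limsup (fun k => {ω | 4 * ε < ‖ξ k ω‖}) atTop ⊆
      ⋃ k, {ω | 2 * ε < ‖∑ i ∈ Finset.range k, ξ (N + i) ω‖} := by
    intro ω hω
    rw [mem_limsup_iff_frequently_mem] at hω
    obtain ⟨k, hk, hkω⟩ := (hω.and_eventually (eventually_ge_atTop N)).exists.imp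
      fun k hk => And.symm hk
    obtain ⟨j, rfl⟩ := Nat.exists_eq_add_of_le hk
    by_contra hn
    simp only [Set.mem_iUnion, Set.mem_ofPred_eq, not_exists, not_lt] at hn hkω
    have e1 := hn (j + 1)
    have e2 := hn j
    rw [Finset.sum_range_succ] at e1
    have e3 := norm_sub_le (∑ i ∈ Finset.range j, ξ (N + i) ω + ξ (N + j) ω)
      (∑ i ∈ Finset.range j, ξ (N + i) ω)
    rw [add_sub_cancel_left] at e3
    linarith
  have h4 := (measure_mono h3).trans h2
  rw [h1] at h4
  exact absurd h4 (not_le.2 ENNReal.one_half_lt_one)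

end Maximal

/-! ### Boundedness in probability -/

section BoundedInProbability

open Filter Topology
open scoped ENNReal

variable {Ω F : Type*} [MeasurableSpace Ω] {μ : Measure Ω} [NormedAddCommGroup F]
  {U V : ℕ → Ω → F}

/-- The family `U` is bounded in probability, that is, the laws of the norms `‖U n‖` are tight. No
measurability is assumed: outside the measurable sets `μ` is the outer measure. -/
def BoundedInProbability (U : ℕ → Ω → F) (μ : Measure Ω) : Prop :=
  ∀ δ : ℝ≥0∞, 0 < δ → ∃ K : ℝ, ∀ n, μ {ω | K < ‖U n ω‖} ≤ δ

theorem BoundedInProbability.map {G : Type*} [NormedAddCommGroup G] [NormedSpace ℂ F]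
    [NormedSpace ℂ G] (hV : BoundedInProbability V μ) (L : F →L[ℂ] G) :
    BoundedInProbability (fun n ω => L (V n ω)) μ := by
  intro δ hδ
  obtain ⟨K, hK⟩ := hV δ hδ
  refine ⟨‖L‖ * K, fun n => (measure_mono fun ω hω => ?_).trans (hK n)⟩
  by_contra hn
  exact not_lt.2 ((L.le_opNorm _).trans
    (mul_le_mul_of_nonneg_left (not_lt.1 hn) (norm_nonneg L))) hω

theorem BoundedInProbability.add (hU : BoundedInProbability U μ) (hV : BoundedInProbability V μ) :
    BoundedInProbability (fun n ω => U n ω + V n ω) μ := by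
  intro δ hδ
  obtain ⟨K, hK⟩ := hU (δ / 2) (ENNReal.half_pos hδ.ne')
  obtain ⟨K', hK'⟩ := hV (δ / 2) (ENNReal.half_pos hδ.ne')
  refine ⟨K + K', fun n => ?_⟩
  calc μ {ω | K + K' < ‖U n ω + V n ω‖} ≤ μ ({ω | K < ‖U n ω‖} ∪ {ω | K' < ‖V n ω‖}) := by
        refine measure_mono fun ω hω => ?_
        by_contra hn
        have hn' : ¬ (K < ‖U n ω‖ ∨ K' < ‖V n ω‖) := hn
        rw [not_or, not_lt, not_lt] at hn'
        exact not_lt.2 ((norm_add_le _ _).trans (add_le_add hn'.1 hn'.2)) hω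
    _ ≤ δ / 2 + δ / 2 := (measure_union_le _ _).trans (add_le_add (hK n) (hK' n))
    _ = δ := ENNReal.add_halves δ

theorem BoundedInProbability.neg (hU : BoundedInProbability U μ) :
    BoundedInProbability (fun n ω => -U n ω) μ := by
  simpa only [BoundedInProbability, norm_neg] using hU

theorem BoundedInProbability.sum {ι : Type*} {V : ι → ℕ → Ω → F} {s : Finset ι}
    (hV : ∀ i ∈ s, BoundedInProbability (V i) μ) :
    BoundedInProbability (fun n ω => ∑ i ∈ s, V i n ω) μ := by
  classical
  induction s using Finset.induction_on with
  | empty => exact fun δ _ => ⟨0, fun n => by simp⟩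
  | insert a s ha ih =>
    simp only [Finset.sum_insert ha]
    exact (hV a (Finset.mem_insert_self a s)).add
      (ih fun i hi => hV i (Finset.mem_insert_of_mem hi))

theorem boundedInProbability_of_identDistrib [MeasurableSpace F] [BorelSpace F]
    [IsFiniteMeasure μ] {X : Ω → F} (hX : Measurable X) (hV : ∀ n, IdentDistrib (V n) X μ μ) :
    BoundedInProbability V μ := by
  intro δ hδ
  have hm : ∀ K : ℝ, MeasurableSet {x : F | K < ‖x‖} := fun K =>
    measurableSet_lt measurable_const measurable_norm
  have hlim : Tendsto (fun K : ℕ => μ {ω | (K : ℝ) < ‖X ω‖}) atTop (𝓝 0) := by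
    have h1 := tendsto_measure_iInter_atTop (μ := μ) (s := fun K : ℕ => {ω | (K : ℝ) < ‖X ω‖})
      (fun K => (hX (hm K)).nullMeasurableSet)
      (fun i j hij ω (hω : (j : ℝ) < ‖X ω‖) =>
        lt_of_le_of_lt (Nat.cast_le.2 hij) hω) ⟨0, measure_ne_top _ _⟩
    have h2 : (⋂ K : ℕ, {ω | (K : ℝ) < ‖X ω‖}) = ∅ := by
      refine Set.eq_empty_of_forall_notMem fun ω hω => ?_
      obtain ⟨K, hK⟩ := exists_nat_ge ‖X ω‖
      exact not_lt.2 hK (Set.mem_iInter.1 hω K)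
    rwa [h2, measure_empty] at h1
  obtain ⟨K, hK⟩ := (hlim.eventually_le_const hδ).exists
  exact ⟨K, fun n => ((hV n).measure_mem_eq (hm K)).trans_le hK⟩

end BoundedInProbability

/-! ### Recursions with a power-contracting operator -/

section Recursion

open Filter Topology
open scoped ENNReal

variable {Ω F : Type*} [MeasurableSpace Ω] {μ : Measure Ω} [NormedAddCommGroup F] [NormedSpace ℂ F]
  {T : F →L[ℂ] F} {U W : ℕ → Ω → F}

theorem tendsto_measure_norm_pow_apply (hT : IsPowerContracting T)
    (hU : BoundedInProbability U μ) {ε : ℝ} (hε : 0 < ε) :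
    Tendsto (fun n => μ {ω | ε ≤ ‖(T ^ n) (U n ω)‖}) atTop (𝓝 0) := by
  obtain ⟨C, r, hC, hr0, hr1, hT⟩ := hT
  rw [ENNReal.tendsto_atTop_zero]
  intro δ hδ
  obtain ⟨K, hK⟩ := hU δ hδ
  have hlim : Tendsto (fun n : ℕ => C * r ^ n * |K|) atTop (𝓝 0) := by
    simpa using ((tendsto_pow_atTop_nhds_zero_of_lt_one hr0.le hr1).const_mul C).mul_const |K|
  obtain ⟨N, hN⟩ := eventually_atTop.1 (hlim.eventually_lt_const hε)
  refine ⟨N, fun n hn => (measure_mono fun ω hω => ?_).trans (hK n)⟩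
  by_contra hlt
  have h1 : ‖U n ω‖ ≤ |K| := (not_lt.1 hlt).trans (le_abs_self K)
  have h2 : ε ≤ ‖(T ^ n) (U n ω)‖ := hω
  have h3 : ‖(T ^ n) (U n ω)‖ ≤ C * r ^ n * |K| :=
    ((T ^ n).le_opNorm _).trans (by gcongr; exact hT n)
  have := hN n hn
  linarith

theorem ae_eq_sum_add_of_recursion (hrec : ∀ n, ∀ᵐ ω ∂μ, U n ω = T (U (n + 1) ω) + W n ω) :
    ∀ᵐ ω ∂μ, ∀ n, U 0 ω = ∑ i ∈ Finset.range n, (T ^ i) (W i ω) + (T ^ n) (U n ω) := by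
  filter_upwards [ae_all_iff.2 hrec] with ω hω n
  induction n with
  | zero => simp
  | succ n ih =>
    rw [ih, Finset.sum_range_succ, hω n, map_add, pow_succ, mul_apply_eq_comp]
    abel

variable [MeasurableSpace F] [BorelSpace F]

/-- The doubling trick: `‖T ^ (m + n) x‖ ≤ C r ^ m` as soon as `‖T ^ n x‖ ≤ 1`, so that summable
probabilities of `‖T ^ n W‖ > 1` already force geometric decay. -/
theorem ae_summable_norm_pow_apply
    (hT : IsPowerContracting T)
    {X : Ω → F} (hid : ∀ n, IdentDistrib (W n) X μ μ)
    (hsum : ∑' n, μ {ω | 1 < ‖(T ^ n) (X ω)‖} ≠ ⊤) :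
    ∀ᵐ ω ∂μ, Summable fun n => ‖(T ^ n) (W n ω)‖ := by
  obtain ⟨C, r, hC, hr0, hr1, hT⟩ := hT
  have hbound : ∀ n, μ {ω | C * r ^ (n - n / 2) < ‖(T ^ n) (W n ω)‖} ≤
      μ {ω | 1 < ‖(T ^ (n / 2)) (X ω)‖} := by
    intro n
    have hset : MeasurableSet {x : F | C * r ^ (n - n / 2) < ‖(T ^ n) x‖} :=
      measurableSet_lt measurable_const (T ^ n).continuous.norm.measurable
    have h1 : μ {ω | C * r ^ (n - n / 2) < ‖(T ^ n) (W n ω)‖} =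
        μ {ω | C * r ^ (n - n / 2) < ‖(T ^ n) (X ω)‖} := (hid n).measure_mem_eq hset
    rw [h1]
    refine measure_mono fun ω hω => ?_
    by_contra hn
    have h2 : ‖(T ^ (n / 2)) (X ω)‖ ≤ 1 := not_lt.1 hn
    have h3 : (T ^ n) (X ω) = (T ^ (n - n / 2)) ((T ^ (n / 2)) (X ω)) := by
      rw [← mul_apply_eq_comp, ← pow_add, Nat.sub_add_cancel (Nat.div_le_self n 2)]
    have h4 : ‖(T ^ n) (X ω)‖ ≤ C * r ^ (n - n / 2) := by
      rw [h3]
      calc _ ≤ ‖T ^ (n - n / 2)‖ * ‖(T ^ (n / 2)) (X ω)‖ := ContinuousLinearMap.le_opNorm _ _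
        _ ≤ C * r ^ (n - n / 2) * 1 := by gcongr; exact hT _
        _ = _ := mul_one _
    exact not_lt.2 h4 hω
  have hfin : ∑' n, μ {ω | C * r ^ (n - n / 2) < ‖(T ^ n) (W n ω)‖} ≠ ⊤ := by
    refine ne_top_of_le_ne_top ?_ (ENNReal.tsum_le_tsum hbound)
    have : ∑' n, μ {ω | 1 < ‖(T ^ (n / 2)) (X ω)‖} =
        ∑' n, μ {ω | 1 < ‖(T ^ n) (X ω)‖} + ∑' n, μ {ω | 1 < ‖(T ^ n) (X ω)‖} := by
      rw [← tsum_even_add_odd ENNReal.summable ENNReal.summable]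
      congr 1
      · refine tsum_congr fun n => ?_
        rw [Nat.mul_div_cancel_left n two_pos]
      · refine tsum_congr fun n => ?_
        rw [show (2 * n + 1) / 2 = n by omega]
    rw [this]
    exact ENNReal.add_ne_top.2 ⟨hsum, hsum⟩
  filter_upwards [ae_eventually_notMem hfin] with ω hω
  obtain ⟨s, hs0, hs⟩ : ∃ s : ℝ, 0 < s ∧ s ^ 2 = r := ⟨√r, Real.sqrt_pos.2 hr0, Real.sq_sqrt hr0.le⟩
  have hs1 : s < 1 := by nlinarith
  refine Summable.of_norm_bounded_eventually_nat (g := fun n => C * s ^ n)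
    ((summable_geometric_of_lt_one hs0.le hs1).mul_left C) ?_
  filter_upwards [hω] with n hn
  rw [norm_norm]
  refine (not_lt.1 hn).trans ?_
  rw [← hs, ← pow_mul]
  gcongr ?_ * ?_
  exact pow_le_pow_of_le_one hs0.le hs1.le (by omega)

variable [IsProbabilityMeasure μ] [SecondCountableTopology F]

/-- Iterating the recursion bounds the partial sums of `∑ T ^ i W_i` between `m` and `n` by the
remainders `T ^ m U_m` and `T ^ n U_n`, which tend to zero in probability. -/
theorem tsum_measure_pow_ne_top
    (hT : IsPowerContracting T) (hU : BoundedInProbability U μ)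
    (hrec : ∀ n, ∀ᵐ ω ∂μ, U n ω = T (U (n + 1) ω) + W n ω)
    (hW : ∀ n, Measurable (W n)) (hind : iIndepFun W μ)
    (hid : ∀ n, IdentDistrib (W n) (W 0) μ μ) :
    ∑' n, μ {ω | 1 < ‖(T ^ n) (W 0 ω)‖} ≠ ⊤ := by
  have hm := tendsto_measure_norm_pow_apply hT hU (ε := 8⁻¹) (by norm_num)
  have h8 : (0 : ℝ≥0∞) < 8⁻¹ := ENNReal.inv_pos.2 ENNReal.ofNat_ne_top
  obtain ⟨N, hN⟩ := eventually_atTop.1 (hm.eventually_le_const h8)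
  have hTm : ∀ n, Measurable fun x => (T ^ n) x := fun n => (T ^ n).continuous.measurable
  have hsmall : ∀ m n, N ≤ m → m ≤ n →
      μ {ω | 4⁻¹ < ‖∑ i ∈ Finset.Ico m n, (T ^ i) (W i ω)‖} ≤ 4⁻¹ := by
    intro m n hm hmn
    have hsub : {ω | 4⁻¹ < ‖∑ i ∈ Finset.Ico m n, (T ^ i) (W i ω)‖} ≤ᵐ[μ]
        ({ω | 8⁻¹ ≤ ‖(T ^ m) (U m ω)‖} ∪ {ω | 8⁻¹ ≤ ‖(T ^ n) (U n ω)‖} : Set Ω) := by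
      filter_upwards [ae_eq_sum_add_of_recursion hrec] with ω hω hlt
      have e1 := (hω m).symm.trans (hω n)
      rw [← Finset.sum_range_add_sum_Ico _ hmn, add_assoc, add_right_inj] at e1
      have e2 : ∑ i ∈ Finset.Ico m n, (T ^ i) (W i ω) = (T ^ m) (U m ω) - (T ^ n) (U n ω) := by
        rw [e1, add_sub_cancel_right]
      have hlt' : 4⁻¹ < ‖∑ i ∈ Finset.Ico m n, (T ^ i) (W i ω)‖ := hlt
      rw [e2] at hlt'
      have e3 := norm_sub_le ((T ^ m) (U m ω)) ((T ^ n) (U n ω))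
      by_contra hn
      have hn' : ¬ (8⁻¹ ≤ ‖(T ^ m) (U m ω)‖ ∨ 8⁻¹ ≤ ‖(T ^ n) (U n ω)‖) := hn
      rw [not_or, not_le, not_le] at hn'
      linarith [hn'.1, hn'.2]
    calc _ ≤ μ ({ω | 8⁻¹ ≤ ‖(T ^ m) (U m ω)‖} ∪ {ω | 8⁻¹ ≤ ‖(T ^ n) (U n ω)‖}) :=
          measure_mono_ae hsub
      _ ≤ 8⁻¹ + 8⁻¹ := (measure_union_le _ _).trans
          (add_le_add (hN m hm) (hN n (hm.trans hmn)))
      _ = 4⁻¹ := by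
          rw [show (8 : ℝ≥0∞) = 2 * 4 by norm_num,
            ENNReal.mul_inv (Or.inl two_ne_zero) (Or.inl ENNReal.ofNat_ne_top), ← add_mul,
            ENNReal.inv_two_add_inv_two, one_mul]
  have hfin := tsum_measure_norm_gt_ne_top (ξ := fun i ω => (T ^ i) (W i ω)) (ε := 4⁻¹)
    (fun i => (hTm i).comp (hW i)) (hind.comp (fun i x => (T ^ i) x) hTm) hsmall
  have hdist : ∀ n, μ {ω | 1 < ‖(T ^ n) (W 0 ω)‖} = μ {ω | 4 * 4⁻¹ < ‖(T ^ n) (W n ω)‖} := by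
    intro n
    have hset : MeasurableSet {x : F | 1 < ‖(T ^ n) x‖} :=
      measurableSet_lt measurable_const (hTm n).norm
    rw [mul_inv_cancel₀ (by norm_num)]
    exact ((hid n).measure_mem_eq hset).symm
  rwa [tsum_congr hdist]

theorem ae_eq_tsum_of_recursion [CompleteSpace F]
    (hT : IsPowerContracting T) (hU : BoundedInProbability U μ)
    (hrec : ∀ n, ∀ᵐ ω ∂μ, U n ω = T (U (n + 1) ω) + W n ω) (hW : ∀ n, Measurable (W n))
    (hsum : ∀ᵐ ω ∂μ, Summable fun n => ‖(T ^ n) (W n ω)‖) :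
    ∀ᵐ ω ∂μ, U 0 ω = ∑' n, (T ^ n) (W n ω) := by
  have hTm : ∀ n, Measurable fun x => (T ^ n) x := fun n => (T ^ n).continuous.measurable
  have h1 : TendstoInMeasure μ (fun n ω => ∑ i ∈ Finset.range n, (T ^ i) (W i ω)) atTop
      (fun ω => ∑' n, (T ^ n) (W n ω)) := by
    refine tendstoInMeasure_of_tendsto_ae (fun n => ?_) ?_
    · exact (Finset.measurable_fun_sum _ fun i _ =>
        (hTm i).comp (hW i)).aestronglyMeasurable
    · filter_upwards [hsum] with ω hω
      exact hω.of_norm.hasSum.tendsto_sum_nat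
  have h2 : TendstoInMeasure μ (fun n ω => ∑ i ∈ Finset.range n, (T ^ i) (W i ω)) atTop (U 0) := by
    rw [tendstoInMeasure_iff_norm]
    intro ε hε
    refine (tendsto_measure_norm_pow_apply hT hU hε).congr fun n => ?_
    refine measure_congr ?_
    filter_upwards [ae_eq_sum_add_of_recursion hrec] with ω hω
    have : ‖(T ^ n) (U n ω)‖ = ‖∑ i ∈ Finset.range n, (T ^ i) (W i ω) - U 0 ω‖ := by
      rw [hω n, sub_add_cancel_left, norm_neg]
    exact congrArg (fun x => ε ≤ x) this
  exact tendstoInMeasure_ae_unique h2 h1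

end Recursion

/-! ### The moving-average series along a fixed path of the noise -/

section Path

variable {E : Type*} [NormedAddCommGroup E] [NormedSpace ℂ E] {A : E →L[ℂ] E}

/-- `∑_{k=0}^q Λ₁^{q-k} I₁ S⁻¹ B_k`, the operator in the infinite part of `X⁽¹⁾`. -/
def stableCoeff (A : E →L[ℂ] E) (q : ℕ) (B : ℕ → E →L[ℂ] E) : E →L[ℂ] stableSpace A :=
  ∑ k ∈ Finset.range (q + 1), (stableOp A ^ (q - k)) ∘L stablePart A ∘L B k

/-- `∑_{k=0}^q Λ₂^{q-k} I₂ S⁻¹ B_k`, the operator in the infinite part of `X⁽²⁾`. -/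
def unstableCoeff (A : E →L[ℂ] E) (q : ℕ) (B : ℕ → E →L[ℂ] E) : E →L[ℂ] unstableSpace A :=
  ∑ k ∈ Finset.range (q + 1), (unstableOp A ^ (q - k)) ∘L unstablePart A ∘L B k

/-- The first `m` summands of the series of `X⁽²⁾`. For `m = q` these are the summands whose
coefficients do not yet involve all of `B_0, …, B_q`. -/
def unstableHead (A : E →L[ℂ] E) (q : ℕ) (B : ℕ → E →L[ℂ] E) (z : ℤ → E) (t : ℤ) (m : ℕ) :
    unstableSpace A :=
  ∑ n ∈ Finset.range m, unstableTerm A q B z t n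

variable {q : ℕ} {B : ℕ → E →L[ℂ] E} {z : ℤ → E}

theorem stableCoeff_succ (q : ℕ) (x : E) :
    stableCoeff A (q + 1) B x =
      stableOp A (stableCoeff A q B x) + stablePart A (B (q + 1) x) := by
  simp only [stableCoeff]
  rw [Finset.sum_range_succ]
  simp only [_root_.add_apply, sum_apply, ContinuousLinearMap.comp_apply, map_sum, Nat.sub_self,
    pow_zero, one_apply_eq_self]
  congr 1
  refine Finset.sum_congr rfl fun k hk => ?_
  rw [Nat.succ_sub (Finset.mem_range_succ_iff.1 hk), pow_succ', mul_apply_eq_comp]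

theorem stableHead_succ (q : ℕ) (t : ℤ) :
    stableHead A (q + 1) B z t = stableHead A q B z t + stableCoeff A q B (z (t - q)) :=
  Finset.sum_range_succ _ _

/-- Subtracting the finite part turns the moving average of order `q` into a single noise term. -/
theorem stableHead_sub (q : ℕ) (t : ℤ) :
    stableHead A q B z t - stableOp A (stableHead A q B z (t - 1)) +
      stableCoeff A q B (z (t - q)) =
      ∑ k ∈ Finset.range (q + 1), stablePart A (B k (z (t - k))) := by
  induction q with
  | zero => simp [stableHead, stableCoeff]
  | succ q ih =>
    have e : t - 1 - (q : ℤ) = t - ((q + 1 : ℕ) : ℤ) := by push_cast; ring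
    rw [Finset.sum_range_succ, ← ih, stableHead_succ, stableHead_succ, map_add, stableCoeff_succ, e]
    abel

theorem stableTerm_eq (t : ℤ) (n : ℕ) :
    stableTerm A q B z t n = (stableOp A ^ n) (stableCoeff A q B (z (t - (q + n)))) := rfl

theorem stableTerm_succ (t : ℤ) (n : ℕ) :
    stableTerm A q B z t (n + 1) = stableOp A (stableTerm A q B z (t - 1) n) := by
  have e : t - ((q : ℤ) + ((n + 1 : ℕ) : ℤ)) = t - 1 - (q + n) := by push_cast; ring
  rw [stableTerm_eq, stableTerm_eq, e, pow_succ', mul_apply_eq_comp]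

theorem unstableTerm_of_le {n : ℕ} (hn : q ≤ n) (t : ℤ) :
    unstableTerm A q B z t n =
      (Ring.inverse (unstableOp A) ^ (n + 1)) (unstableCoeff A q B (z (t + (1 - q + n)))) := by
  rw [unstableTerm, unstableCoeff, Nat.sub_eq_zero_of_le hn, Nat.range_succ_eq_Icc_zero]

theorem unstableTerm_succ {n : ℕ} (hn : q ≤ n) (t : ℤ) :
    unstableTerm A q B z t (n + 1) =
      Ring.inverse (unstableOp A) (unstableTerm A q B z (t + 1) n) := by
  have e : t + (1 - (q : ℤ) + ((n + 1 : ℕ) : ℤ)) = t + 1 + (1 - q + n) := by push_cast; ring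
  rw [unstableTerm_of_le hn, unstableTerm_of_le (by omega), e, pow_succ' _ (n + 1),
    mul_apply_eq_comp]

/-- The identity for the first `m ≤ q` summands, which the induction on `m` needs; all the terms
cancel except for one boundary term. -/
theorem unstableHead_sub_aux (hu : IsUnit (unstableOp A)) (t : ℤ) {m : ℕ} (hm : m ≤ q) :
    unstableHead A q B z t m -
      Ring.inverse (unstableOp A) (unstableHead A q B z (t + 1) m) + unstableTerm A q B z t m =
      Ring.inverse (unstableOp A)
        (∑ k ∈ Finset.Icc (q - m) q, unstablePart A (B k (z (t + 1 - k)))) := by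
  induction m with
  | zero =>
    have e : t + (1 - (q : ℤ)) = t + 1 - q := by ring
    simp [unstableHead, unstableTerm, e]
  | succ m ih =>
    have hsplit : Finset.Icc (q - (m + 1)) q = insert (q - (m + 1)) (Finset.Icc (q - m) q) := by
      ext k; simp only [Finset.mem_Icc, Finset.mem_insert]; omega
    have hnot : q - (m + 1) ∉ Finset.Icc (q - m) q := by
      simp only [Finset.mem_Icc]; omega
    have e1 : t + 1 + (1 - (q : ℤ) + (m : ℤ)) = t + (1 - q + ((m + 1 : ℕ) : ℤ)) := by
      push_cast; ring
    have e2 : t + 1 - ((q - (m + 1) : ℕ) : ℤ) = t + (1 - q + ((m + 1 : ℕ) : ℤ)) := by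
      rw [Nat.cast_sub hm]; push_cast; ring
    have hcancel : ∀ x, (Ring.inverse (unstableOp A) ^ (m + 1 + 1)) ((unstableOp A ^ (m + 1)) x) =
        Ring.inverse (unstableOp A) x := by
      intro x
      have hpow : Ring.inverse (unstableOp A) ^ (m + 1) * unstableOp A ^ (m + 1) = 1 := by
        have hcomm : Commute (Ring.inverse (unstableOp A)) (unstableOp A) :=
          (Ring.inverse_mul_cancel _ hu).trans (Ring.mul_inverse_cancel _ hu).symm
        rw [← hcomm.mul_pow, Ring.inverse_mul_cancel _ hu, one_pow]
      rw [pow_succ' _ (m + 1), mul_apply_eq_comp]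
      exact congrArg (fun y => Ring.inverse (unstableOp A) y) (DFunLike.congr_fun hpow x)
    have hterm : unstableTerm A q B z t (m + 1) =
        Ring.inverse (unstableOp A) (unstableTerm A q B z (t + 1) m) +
        Ring.inverse (unstableOp A)
          (unstablePart A (B (q - (m + 1)) (z (t + 1 - ((q - (m + 1) : ℕ) : ℤ))))) := by
      have e3 : q - (q - (m + 1)) = m + 1 := by omega
      rw [unstableTerm, unstableTerm, hsplit, Finset.sum_insert hnot, _root_.add_apply, map_add, e1,
        ← e2, ContinuousLinearMap.comp_apply, ContinuousLinearMap.comp_apply, e3, hcancel,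
        pow_succ' _ (m + 1), mul_apply_eq_comp, add_comm]
    rw [hterm, hsplit, Finset.sum_insert hnot, map_add, ← ih (by omega), unstableHead, unstableHead,
      Finset.sum_range_succ, Finset.sum_range_succ, map_add, unstableHead, unstableHead]
    abel

/-- The counterpart of `stableHead_sub` for the recursion run backwards in time. -/
theorem unstableHead_sub (hu : IsUnit (unstableOp A)) (t : ℤ) :
    unstableHead A q B z t q -
      Ring.inverse (unstableOp A) (unstableHead A q B z (t + 1) q) + unstableTerm A q B z t q =
      Ring.inverse (unstableOp A)
        (∑ k ∈ Finset.range (q + 1), unstablePart A (B k (z (t + 1 - k)))) := by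
  rw [unstableHead_sub_aux hu t le_rfl, Nat.sub_self, Nat.range_succ_eq_Icc_zero]

theorem inverse_apply_apply (hu : IsUnit (unstableOp A)) (x : unstableSpace A) :
    Ring.inverse (unstableOp A) (unstableOp A x) = x :=
  DFunLike.congr_fun (Ring.inverse_mul_cancel _ hu) x

theorem apply_inverse_apply (hu : IsUnit (unstableOp A)) (x : unstableSpace A) :
    unstableOp A (Ring.inverse (unstableOp A) x) = x :=
  DFunLike.congr_fun (Ring.mul_inverse_cancel _ hu) x

variable [CompleteSpace E]

theorem stableSol_sub (hA : spectrum ℂ A ∩ {z : ℂ | ‖z‖ = 1} = ∅) (t : ℤ)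
    (h : ∀ t, Summable fun n => ‖stableTerm A q B z t n‖) :
    stableSol A q B z t - stableOp A (stableSol A q B z (t - 1)) =
      ∑ k ∈ Finset.range (q + 1), stablePart A (B k (z (t - k))) := by
  have := completeSpace_stableSpace hA
  have h1 : ∑' n, stableTerm A q B z t n = stableCoeff A q B (z (t - q)) +
      stableOp A (∑' n, stableTerm A q B z (t - 1) n) := by
    rw [(h t).of_norm.tsum_eq_zero_add, (stableOp A).map_tsum (h (t - 1)).of_norm]
    simp only [stableTerm_succ]
    simp [stableTerm_eq]
  rw [stableSol, stableSol, h1, map_add, ← stableHead_sub]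
  abel

theorem unstableSol_sub (hA : spectrum ℂ A ∩ {z : ℂ | ‖z‖ = 1} = ∅) (t : ℤ)
    (h : ∀ t, Summable fun n => ‖unstableTerm A q B z t n‖) :
    unstableSol A q B z t - unstableOp A (unstableSol A q B z (t - 1)) =
      ∑ k ∈ Finset.range (q + 1), unstablePart A (B k (z (t - k))) := by
  have := completeSpace_unstableSpace hA
  have hu := isUnit_unstableOp hA
  have hs : ∀ t, Summable fun n => unstableTerm A q B z t (n + q) := fun t =>
    (summable_nat_add_iff q).2 (h t).of_norm
  have h0 : ∀ t, ∑' n, unstableTerm A q B z t n =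
      unstableHead A q B z t q + ∑' n, unstableTerm A q B z t (n + q) := fun t =>
    ((h t).of_norm.sum_add_tsum_nat_add q).symm
  have h1 : ∑' n, unstableTerm A q B z (t - 1) (n + q) = unstableTerm A q B z (t - 1) q +
      Ring.inverse (unstableOp A) (∑' n, unstableTerm A q B z t (n + q)) := by
    rw [(hs (t - 1)).tsum_eq_zero_add, ContinuousLinearMap.map_tsum _ (hs t), zero_add]
    congr 1
    refine tsum_congr fun n => ?_
    rw [show n + 1 + q = (n + q) + 1 by ring, unstableTerm_succ (by omega), sub_add_cancel]
  have h2 := unstableHead_sub (q := q) (B := B) (z := z) hu (t - 1)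
  rw [sub_add_cancel] at h2
  have h3 : ∑' n, unstableTerm A q B z (t - 1) n -
      Ring.inverse (unstableOp A) (∑' n, unstableTerm A q B z t n) =
      Ring.inverse (unstableOp A)
        (∑ k ∈ Finset.range (q + 1), unstablePart A (B k (z (t - k)))) := by
    rw [h0, h0, h1, map_add, ← h2]
    abel
  have h4 := congrArg (unstableOp A) h3
  rw [map_sub, apply_inverse_apply hu, apply_inverse_apply hu] at h4
  rw [unstableSol, unstableSol, map_neg, ← h4]
  abel

/-- The series solve the equation along every path for which they converge absolutely. -/
theorem splitMap_sol_sub (hA : spectrum ℂ A ∩ {z : ℂ | ‖z‖ = 1} = ∅) (t : ℤ)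
    (h₁ : ∀ t, Summable fun n => ‖stableTerm A q B z t n‖)
    (h₂ : ∀ t, Summable fun n => ‖unstableTerm A q B z t n‖) :
    splitMap A (stableSol A q B z t, unstableSol A q B z t) -
      A (splitMap A (stableSol A q B z (t - 1), unstableSol A q B z (t - 1))) =
      ∑ k ∈ Finset.range (q + 1), B k (z (t - k)) := by
  have hblock : ∀ p, A (splitMap A p) = splitMap A (stableOp A p.1, unstableOp A p.2) := by
    intro p
    have e1 := DFunLike.congr_fun (splitInv_comp_comp_splitMap hA) p
    have e2 := DFunLike.congr_fun (splitMap_comp_splitInv A) (A (splitMap A p))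
    exact e2.symm.trans (congrArg (splitMap A) e1)
  rw [hblock, ← map_sub, Prod.mk_sub_mk, stableSol_sub hA t h₁, unstableSol_sub hA t h₂,
    ← map_sum, ← map_sum]
  exact DFunLike.congr_fun (splitMap_comp_splitInv A) _

theorem stablePart_pow_apply (hA : spectrum ℂ A ∩ {z : ℂ | ‖z‖ = 1} = ∅) (n : ℕ) (x : E) :
    stablePart A ((A ^ n) x) = (stableOp A ^ n) (stablePart A x) := by
  induction n with
  | zero => rfl
  | succ n ih => rw [pow_succ', pow_succ', mul_apply_eq_comp, mul_apply_eq_comp, ← ih,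
      stablePart_apply_map hA]

theorem unstablePart_pow_apply (hA : spectrum ℂ A ∩ {z : ℂ | ‖z‖ = 1} = ∅) (n : ℕ) (x : E) :
    unstablePart A ((A ^ n) x) = (unstableOp A ^ n) (unstablePart A x) := by
  induction n with
  | zero => rfl
  | succ n ih => rw [pow_succ', pow_succ', mul_apply_eq_comp, mul_apply_eq_comp, ← ih,
      unstablePart_apply_map hA]

theorem stableCoeff_apply (hA : spectrum ℂ A ∩ {z : ℂ | ‖z‖ = 1} = ∅) (x : E) :
    stableCoeff A q B x =
      stablePart A ((∑ k ∈ Finset.range (q + 1), (A ^ (q - k)) ∘L B k) x) := by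
  simp only [stableCoeff, sum_apply, map_sum, ContinuousLinearMap.comp_apply,
    stablePart_pow_apply hA]

theorem unstableCoeff_apply (hA : spectrum ℂ A ∩ {z : ℂ | ‖z‖ = 1} = ∅) (x : E) :
    unstableCoeff A q B x =
      unstablePart A ((∑ k ∈ Finset.range (q + 1), (A ^ (q - k)) ∘L B k) x) := by
  simp only [unstableCoeff, sum_apply, map_sum, ContinuousLinearMap.comp_apply,
    unstablePart_pow_apply hA]

end Path

/-! ### Logarithmic moments -/

section LogMoments

open Filter Topology
open scoped ENNReal

variable {Ω F : Type*} [MeasurableSpace Ω] {μ : Measure Ω} [NormedAddCommGroup F]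
  {W : Ω → F}

theorem lintegral_posLog_map_lt_top [NormedSpace ℂ F] {G : Type*} [NormedAddCommGroup G]
    [NormedSpace ℂ G]
    [IsProbabilityMeasure μ] (L : F →L[ℂ] G)
    (hlog : ∫⁻ ω, ENNReal.ofReal (Real.posLog ‖W ω‖) ∂μ < ⊤) :
    ∫⁻ ω, ENNReal.ofReal (Real.posLog ‖L (W ω)‖) ∂μ < ⊤ := by
  have hpt : ∀ ω, ENNReal.ofReal (Real.posLog ‖L (W ω)‖) ≤
      ENNReal.ofReal (Real.posLog ‖L‖) + ENNReal.ofReal (Real.posLog ‖W ω‖) := by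
    intro ω
    rw [← ENNReal.ofReal_add Real.posLog_nonneg Real.posLog_nonneg]
    exact ENNReal.ofReal_le_ofReal ((Real.posLog_le_posLog (norm_nonneg _)
      (L.le_opNorm _)).trans Real.posLog_mul)
  refine (lintegral_mono hpt).trans_lt ?_
  rw [lintegral_add_left measurable_const]
  simpa using hlog

theorem lintegral_posLog_add_lt_top [MeasurableSpace F] [BorelSpace F] [IsProbabilityMeasure μ]
    {W' : Ω → F} (hW : Measurable W)
    (h : ∫⁻ ω, ENNReal.ofReal (Real.posLog ‖W ω‖) ∂μ < ⊤)
    (h' : ∫⁻ ω, ENNReal.ofReal (Real.posLog ‖W' ω‖) ∂μ < ⊤) :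
    ∫⁻ ω, ENNReal.ofReal (Real.posLog ‖W ω + W' ω‖) ∂μ < ⊤ := by
  have hpt : ∀ ω, ENNReal.ofReal (Real.posLog ‖W ω + W' ω‖) ≤
      ENNReal.ofReal (Real.log 2) + (ENNReal.ofReal (Real.posLog ‖W ω‖) +
        ENNReal.ofReal (Real.posLog ‖W' ω‖)) := by
    intro ω
    rw [← ENNReal.ofReal_add Real.posLog_nonneg Real.posLog_nonneg,
      ← ENNReal.ofReal_add (Real.log_nonneg one_le_two)
        (add_nonneg Real.posLog_nonneg Real.posLog_nonneg), ← add_assoc]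
    exact ENNReal.ofReal_le_ofReal ((Real.posLog_le_posLog (norm_nonneg _)
      (norm_add_le _ _)).trans Real.posLog_add)
  refine (lintegral_mono hpt).trans_lt ?_
  rw [lintegral_add_left measurable_const, lintegral_add_left]
  · simpa using ⟨h, h'⟩
  · exact (Real.continuous_posLog.measurable.comp hW.norm).ennreal_ofReal

variable [NormedSpace ℂ F] [MeasurableSpace F] [BorelSpace F] {T : F →L[ℂ] F}

/-- If `T` is bounded below, then `‖T ^ n W‖ ≤ 1` forces `log⁺ ‖W‖ = O(n)`, so that `log⁺ ‖W‖` is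
at most a multiple of the number of `n` with `‖T ^ n W‖ > 1`. -/
theorem lintegral_posLog_lt_top_of_tsum {T' : F →L[ℂ] F} (hT' : T' * T = 1) (hW : Measurable W)
    (hsum : ∑' n, μ {ω | 1 < ‖(T ^ n) (W ω)‖} ≠ ⊤) :
    ∫⁻ ω, ENNReal.ofReal (Real.posLog ‖W ω‖) ∂μ < ⊤ := by
  set c : ℝ := max ‖T'‖ 1 with hc
  have hc1 : 1 ≤ c := le_max_right _ _
  have hlow : ∀ n x, ‖x‖ ≤ c ^ n * ‖(T ^ n) x‖ := by
    intro n
    induction n with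
    | zero => intro x; simp
    | succ n ih =>
      intro x
      have h1 : x = T' (T x) := (DFunLike.congr_fun hT' x).symm
      calc ‖x‖ = ‖T' (T x)‖ := by rw [← h1]
        _ ≤ c * ‖T x‖ := T'.le_of_opNorm_le (le_max_left _ _) _
        _ ≤ c * (c ^ n * ‖(T ^ n) (T x)‖) := by gcongr; exact ih _
        _ = c ^ (n + 1) * ‖(T ^ (n + 1)) x‖ := by rw [pow_succ T, mul_apply_eq_comp]; ring
  set s : ℕ → Set Ω := fun n => {ω | 1 < ‖(T ^ n) (W ω)‖} with hs
  have hsm : ∀ n, MeasurableSet (s n) := fun n =>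
    measurableSet_lt measurable_const ((T ^ n).continuous.measurable.comp hW).norm
  have hpt : ∀ ω, ENNReal.ofReal (Real.posLog ‖W ω‖) ≤
      (ENNReal.ofReal (Real.log c) + 1) * ∑' n, (s n).indicator (fun _ => (1 : ℝ≥0∞)) ω := by
    intro ω
    classical
    by_cases hex : ∃ n, ω ∉ s n
    · have h1 : ‖W ω‖ ≤ c ^ Nat.find hex := by
        have := Nat.find_spec hex
        have h2 : ‖(T ^ Nat.find hex) (W ω)‖ ≤ 1 := not_lt.1 this
        calc ‖W ω‖ ≤ c ^ Nat.find hex * ‖(T ^ Nat.find hex) (W ω)‖ := hlow _ _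
          _ ≤ c ^ Nat.find hex * 1 := by gcongr
          _ = _ := mul_one _
      have h2 : Real.posLog ‖W ω‖ ≤ Nat.find hex * Real.log c := by
        refine (Real.posLog_le_posLog (norm_nonneg _) h1).trans_eq ?_
        rw [Real.posLog_pow, Real.posLog_eq_log (by rwa [abs_of_nonneg (by positivity)])]
      have h3 : (Nat.find hex : ℝ≥0∞) ≤ ∑' n, (s n).indicator (fun _ => (1 : ℝ≥0∞)) ω := by
        calc (Nat.find hex : ℝ≥0∞) = ∑ n ∈ Finset.range (Nat.find hex), 1 := by simp
          _ = ∑ n ∈ Finset.range (Nat.find hex), (s n).indicator (fun _ => (1 : ℝ≥0∞)) ω := by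
            refine Finset.sum_congr rfl fun n hn => ?_
            rw [Set.indicator_of_mem]
            exact not_not.1 (Nat.find_min hex (Finset.mem_range.1 hn))
          _ ≤ _ := ENNReal.sum_le_tsum _
      calc ENNReal.ofReal (Real.posLog ‖W ω‖) ≤ ENNReal.ofReal (Nat.find hex * Real.log c) :=
            ENNReal.ofReal_le_ofReal h2
        _ = ENNReal.ofReal (Real.log c) * Nat.find hex := by
            rw [ENNReal.ofReal_mul (by positivity), ENNReal.ofReal_natCast, mul_comm]
        _ ≤ _ := mul_le_mul' le_self_add h3
    · push Not at hex
      have : ∑' n, (s n).indicator (fun _ => (1 : ℝ≥0∞)) ω = ⊤ := by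
        rw [tsum_congr fun n => Set.indicator_of_mem (hex n) _]
        exact ENNReal.tsum_const_eq_top_of_ne_zero one_ne_zero
      rw [this, ENNReal.mul_top (by simp)]
      exact le_top
  refine (lintegral_mono hpt).trans_lt ?_
  rw [lintegral_const_mul' _ _ (by simp), lintegral_tsum fun n =>
    (measurable_const.indicator (hsm n)).aemeasurable]
  simp only [lintegral_indicator (hsm _), setLIntegral_const, one_mul]
  exact ENNReal.mul_lt_top (by simp) hsum.lt_top

theorem tsum_measure_nat_lt_lt_top [IsProbabilityMeasure μ] {X : Ω → ℝ} (hX : Integrable X μ)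
    (h0 : 0 ≤ X) : ∑' n : ℕ, μ {ω | (n : ℝ) < X ω} < ⊤ :=
  letI : MeasureSpace Ω := ⟨μ⟩
  haveI : IsProbabilityMeasure (volume : Measure Ω) := ‹_›
  tsum_prob_mem_Ioi_lt_top hX h0

/-- `‖T ^ n W‖ > 1` forces `log⁺ C + log⁺ ‖W‖ > n |log r|`, and an integrable variable exceeds `n`
with summable probabilities. -/
theorem tsum_ne_top_of_lintegral_posLog_lt_top [IsProbabilityMeasure μ]
    (hT : IsPowerContracting T) (hW : Measurable W)
    (hlog : ∫⁻ ω, ENNReal.ofReal (Real.posLog ‖W ω‖) ∂μ < ⊤) :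
    ∑' n, μ {ω | 1 < ‖(T ^ n) (W ω)‖} ≠ ⊤ := by
  obtain ⟨C, r, hC, hr0, hr1, hT⟩ := hT
  have hlr : 0 < -Real.log r := neg_pos.2 (Real.log_neg hr0 hr1)
  set X : Ω → ℝ := fun ω => (Real.posLog C + Real.posLog ‖W ω‖) / (-Real.log r) with hX
  have hint : Integrable X μ := by
    refine Integrable.div_const ((integrable_const _).add ?_) _
    refine (lintegral_ofReal_ne_top_iff_integrable ?_ (ae_of_all _ fun ω => Real.posLog_nonneg)).1
      hlog.ne
    exact (Real.continuous_posLog.measurable.comp hW.norm).aestronglyMeasurable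
  have h0 : 0 ≤ X := fun ω =>
    div_nonneg (add_nonneg Real.posLog_nonneg Real.posLog_nonneg) hlr.le
  refine ne_top_of_le_ne_top (tsum_measure_nat_lt_lt_top hint h0).ne
    (ENNReal.tsum_le_tsum fun n => measure_mono fun ω hω => ?_)
  have h1 : 1 < ‖(T ^ n) (W ω)‖ := hω
  have h2 : ‖(T ^ n) (W ω)‖ ≤ C * r ^ n * ‖W ω‖ := (T ^ n).le_of_opNorm_le (hT n) _
  have h3 : 1 < C * r ^ n * ‖W ω‖ := h1.trans_le h2
  have hWpos : 0 < ‖W ω‖ := by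
    by_contra hn
    have : ‖W ω‖ = 0 := le_antisymm (not_lt.1 hn) (norm_nonneg _)
    rw [this, mul_zero] at h3
    linarith
  have h4 : 0 < Real.log C + n * Real.log r + Real.log ‖W ω‖ := by
    have := Real.log_pos h3
    rwa [Real.log_mul (by positivity) hWpos.ne', Real.log_mul hC.ne' (by positivity),
      Real.log_pow] at this
  have h5 : Real.log C ≤ Real.posLog C := le_max_right _ _
  have h6 : Real.log ‖W ω‖ ≤ Real.posLog ‖W ω‖ := le_max_right _ _
  change (n : ℝ) < (Real.posLog C + Real.posLog ‖W ω‖) / (-Real.log r)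
  rw [lt_div_iff₀ hlr]
  linarith

end LogMoments

/-! ### Stationary solutions and their series representation -/

section Noise

variable {Ω E : Type*} [MeasurableSpace Ω] {μ : Measure Ω} [MeasurableSpace E] {Z : ℤ → Ω → E}

theorem IsIIDNoise.identDistrib_of (hZ : IsIIDNoise Z μ) (s t : ℤ) :
    IdentDistrib (Z s) (Z t) μ μ :=
  (hZ.identDistrib s).trans (hZ.identDistrib t).symm

theorem IsIIDNoise.boundedInProbability [NormedAddCommGroup E] [BorelSpace E]
    [IsFiniteMeasure μ] (hZ : IsIIDNoise Z μ) (f : ℕ → ℤ) :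
    BoundedInProbability (fun n => Z (f n)) μ :=
  boundedInProbability_of_identDistrib (hZ.measurable 0) fun n => hZ.identDistrib (f n)

/-- The law of an i.i.d. sequence is invariant under shifts. -/
theorem IsIIDNoise.identDistrib_shift (hZ : IsIIDNoise Z μ) (h : ℤ) :
    IdentDistrib (fun ω t => Z (t + h) ω) (fun ω t => Z t ω) μ μ :=
  IdentDistrib.pi (fun t => hZ.identDistrib_of (t + h) t)
    (hZ.indep.precomp (add_left_injective h)) hZ.indep

end Noise

section Solutions

variable {E : Type*} [NormedAddCommGroup E] [NormedSpace ℂ E] {A : E →L[ℂ] E} {q : ℕ}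
  {B : ℕ → E →L[ℂ] E}

theorem unstableTerm_add (z : ℤ → E) (t : ℤ) (n : ℕ) :
    unstableTerm A q B z t (n + q) = (Ring.inverse (unstableOp A) ^ n)
      ((Ring.inverse (unstableOp A) ^ (q + 1)) (unstableCoeff A q B (z (t + 1 + n)))) := by
  have e : t + (1 - (q : ℤ) + ((n + q : ℕ) : ℤ)) = t + 1 + n := by push_cast; ring
  rw [unstableTerm_of_le (Nat.le_add_left q n), e, ← mul_apply_eq_comp, ← pow_add, add_assoc]

theorem isPowerContracting_stableOp [CompleteSpace E]
    (hA : spectrum ℂ A ∩ {z : ℂ | ‖z‖ = 1} = ∅) : IsPowerContracting (stableOp A) := by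
  have := completeSpace_stableSpace hA
  refine isPowerContracting_of_spectrum _ fun z hz => ?_
  rw [spectrum_stableOp hA] at hz
  exact hz.1

theorem isPowerContracting_inverse_unstableOp [CompleteSpace E]
    (hA : spectrum ℂ A ∩ {z : ℂ | ‖z‖ = 1} = ∅) :
    IsPowerContracting (Ring.inverse (unstableOp A)) := by
  have := completeSpace_unstableSpace hA
  exact isPowerContracting_of_spectrum _ (norm_lt_one_of_mem_spectrum_inverse_unstableOp hA)

variable {Ω : Type*} [MeasurableSpace Ω] {μ : Measure Ω} {Z Y : ℤ → Ω → E}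
  [MeasurableSpace E]


theorem IsStationarySolution.identDistrib (hY : IsStationarySolution A q B Z Y μ) (t : ℤ) :
    IdentDistrib (Y t) (Y 0) μ μ := by
  have h := (hY.stationary {0} t).comp
    (measurable_pi_apply (⟨0, Finset.mem_singleton_self 0⟩ : ({0} : Finset ℤ)))
  simpa [Function.comp_def] using h

variable [BorelSpace E]

theorem IsStationarySolution.boundedInProbability [IsProbabilityMeasure μ]
    (hY : IsStationarySolution A q B Z Y μ)
    (f : ℕ → ℤ) : BoundedInProbability (fun n => Y (f n)) μ :=
  boundedInProbability_of_identDistrib (hY.measurable 0) fun n => hY.identDistrib (f n)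

variable [CompleteSpace E]

theorem ae_summable_stableTerm (hA : spectrum ℂ A ∩ {z : ℂ | ‖z‖ = 1} = ∅)
    (hZ : IsIIDNoise Z μ)
    (hsum : ∑' n, μ {ω | 1 < ‖(stableOp A ^ n) (stableCoeff A q B (Z 0 ω))‖} ≠ ⊤) (t : ℤ) :
    ∀ᵐ ω ∂μ, Summable fun n => ‖stableTerm A q B (fun s => Z s ω) t n‖ := by
  have hm : Measurable (stableCoeff A q B) := (stableCoeff A q B).continuous.measurable
  exact ae_summable_norm_pow_apply (W := fun n ω => stableCoeff A q B (Z (t - (q + n)) ω))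
    (isPowerContracting_stableOp hA) (fun n => (hZ.identDistrib_of _ 0).comp hm) hsum

theorem ae_summable_unstableTerm (hA : spectrum ℂ A ∩ {z : ℂ | ‖z‖ = 1} = ∅)
    (hZ : IsIIDNoise Z μ)
    (hsum : ∑' n, μ {ω | 1 < ‖(Ring.inverse (unstableOp A) ^ n)
      ((Ring.inverse (unstableOp A) ^ (q + 1)) (unstableCoeff A q B (Z 0 ω)))‖} ≠ ⊤) (t : ℤ) :
    ∀ᵐ ω ∂μ, Summable fun n => ‖unstableTerm A q B (fun s => Z s ω) t n‖ := by
  set D := (Ring.inverse (unstableOp A) ^ (q + 1)) ∘L unstableCoeff A q B with hD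
  have hm : Measurable D := D.continuous.measurable
  have h := ae_summable_norm_pow_apply (W := fun n ω => D (Z (t + 1 + n) ω))
    (isPowerContracting_inverse_unstableOp hA) (μ := μ)
    (fun n => (hZ.identDistrib_of _ 0).comp hm) hsum
  filter_upwards [h] with ω hω
  rw [← summable_nat_add_iff q]
  simp only [unstableTerm_add]
  exact hω

variable [TopologicalSpace.SeparableSpace E] [IsProbabilityMeasure μ]

/-- With the finite part removed, `I₁ S⁻¹ Y` satisfies `U_t = Λ₁ U_{t-1} + D Z_{t-q}`, a recursion
into the past. The joint law of `Y` and `Z` is not assumed to be stationary, but `U` is bounded in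
probability because each of its summands has a law that does not depend on time. -/
theorem IsStationarySolution.stable_part (hA : spectrum ℂ A ∩ {z : ℂ | ‖z‖ = 1} = ∅)
    (hZ : IsIIDNoise Z μ) (hY : IsStationarySolution A q B Z Y μ) :
    ∑' n, μ {ω | 1 < ‖(stableOp A ^ n) (stableCoeff A q B (Z 0 ω))‖} ≠ ⊤ ∧
      ∀ t, ∀ᵐ ω ∂μ, stablePart A (Y t ω) = stableSol A q B (fun s => Z s ω) t := by
  have : SecondCountableTopology E := UniformSpace.secondCountable_of_separable E
  have := completeSpace_stableSpace hA
  have hT := isPowerContracting_stableOp hA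
  have hm : Measurable (stableCoeff A q B) := (stableCoeff A q B).continuous.measurable
  set U : ℤ → ℕ → Ω → stableSpace A := fun t n ω =>
    stablePart A (Y (t - n) ω) + -stableHead A q B (fun s => Z s ω) (t - n) with hU
  set W : ℤ → ℕ → Ω → stableSpace A := fun t n ω =>
    stableCoeff A q B (Z (t - (q + n)) ω) with hW
  have hbd : ∀ t, BoundedInProbability (U t) μ := fun t => by
    refine ((hY.boundedInProbability fun n => t - n).map (stablePart A)).add
      (BoundedInProbability.neg ?_)
    refine BoundedInProbability.sum fun j _ => ?_
    exact (hZ.boundedInProbability fun n => t - n - j).map _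
  have hrec : ∀ t n, ∀ᵐ ω ∂μ, U t n ω = stableOp A (U t (n + 1) ω) + W t n ω := by
    intro t n
    filter_upwards [hY.equation (t - n)] with ω hω
    have h1 := congrArg (stablePart A) hω
    rw [map_sub, stablePart_apply_map hA, map_sum,
      ← stableHead_sub (z := fun s => Z s ω)] at h1
    have e1 : t - ((n + 1 : ℕ) : ℤ) = t - n - 1 := by push_cast; ring
    have e2 : t - ((q : ℤ) + n) = t - n - q := by ring
    simp only [hU, hW, e1, e2, map_add, map_neg]
    rw [sub_eq_iff_eq_add.1 h1]
    abel
  have hWm : ∀ t n, Measurable (W t n) := fun t n => hm.comp (hZ.measurable _)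
  have hind : ∀ t, iIndepFun (W t) μ := fun t =>
    (hZ.indep.precomp (g := fun n : ℕ => t - (q + n)) fun a b hab => by
      simpa using hab).comp _ fun _ => hm
  have hid : ∀ t n, IdentDistrib (W t n) (W t 0) μ μ := fun t n =>
    (hZ.identDistrib_of _ _).comp hm
  have hsum : ∑' n, μ {ω | 1 < ‖(stableOp A ^ n) (stableCoeff A q B (Z 0 ω))‖} ≠ ⊤ := by
    -- at time `q` the first innovation of the recursion is `Z 0`
    have h := tsum_measure_pow_ne_top hT (hbd q) (hrec q) (hWm q) (hind q) (hid q)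
    simpa only [hW, Nat.cast_zero, add_zero, sub_self] using h
  refine ⟨hsum, fun t => ?_⟩
  filter_upwards [ae_eq_tsum_of_recursion hT (hbd t) (hrec t) (hWm t)
    (ae_summable_stableTerm hA hZ hsum t)] with ω hω
  have h0 : stablePart A (Y t ω) + -stableHead A q B (fun s => Z s ω) t =
      ∑' n, stableTerm A q B (fun s => Z s ω) t n := by
    simp only [hU, Nat.cast_zero, sub_zero] at hω
    exact hω
  rw [stableSol, ← h0]
  abel

/-- With the finite part removed, `I₂ S⁻¹ Y` satisfies
`U_t = Λ₂⁻¹ U_{t+1} - Λ₂^{-(q+1)} D Z_{t+1}`, a recursion into the future. -/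
theorem IsStationarySolution.unstable_part (hA : spectrum ℂ A ∩ {z : ℂ | ‖z‖ = 1} = ∅)
    (hZ : IsIIDNoise Z μ) (hY : IsStationarySolution A q B Z Y μ) :
    ∑' n, μ {ω | 1 < ‖(Ring.inverse (unstableOp A) ^ n)
      ((Ring.inverse (unstableOp A) ^ (q + 1)) (unstableCoeff A q B (Z 0 ω)))‖} ≠ ⊤ ∧
      ∀ t, ∀ᵐ ω ∂μ, unstablePart A (Y t ω) = unstableSol A q B (fun s => Z s ω) t := by
  have : SecondCountableTopology E := UniformSpace.secondCountable_of_separable E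
  have := completeSpace_unstableSpace hA
  have hu := isUnit_unstableOp hA
  have hT := isPowerContracting_inverse_unstableOp hA
  set D := -((Ring.inverse (unstableOp A) ^ (q + 1)) ∘L unstableCoeff A q B) with hD
  have hm : Measurable D := D.continuous.measurable
  set U : ℤ → ℕ → Ω → unstableSpace A := fun t n ω =>
    unstablePart A (Y (t + n) ω) + unstableHead A q B (fun s => Z s ω) (t + n) q with hU
  set W : ℤ → ℕ → Ω → unstableSpace A := fun t n ω => D (Z (t + 1 + n) ω) with hW
  have hterm : ∀ t n ω, (Ring.inverse (unstableOp A) ^ n) (W t n ω) =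
      -unstableTerm A q B (fun s => Z s ω) t (n + q) := by
    intro t n ω
    rw [unstableTerm_add, ← map_neg]
    rfl
  have hbd : ∀ t, BoundedInProbability (U t) μ := fun t => by
    refine ((hY.boundedInProbability fun n => t + n).map (unstablePart A)).add ?_
    refine BoundedInProbability.sum fun j _ => ?_
    exact ((hZ.boundedInProbability fun n => t + n + (1 - q + j)).map _).map _
  have hrec : ∀ t n, ∀ᵐ ω ∂μ,
      U t n ω = Ring.inverse (unstableOp A) (U t (n + 1) ω) + W t n ω := by
    intro t n
    filter_upwards [hY.equation (t + n + 1)] with ω hω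
    have h1 := congrArg (fun x => Ring.inverse (unstableOp A) (unstablePart A x)) hω
    simp only [add_sub_cancel_right] at h1
    rw [map_sub, unstablePart_apply_map hA, map_sub, inverse_apply_apply hu, map_sum,
      ← unstableHead_sub (z := fun s => Z s ω) hu] at h1
    have e1 : t + ((n + 1 : ℕ) : ℤ) = t + n + 1 := by push_cast; ring
    have e2 : W t n ω = -unstableTerm A q B (fun s => Z s ω) (t + n) q := by
      have := hterm (t + n) 0 ω
      rw [zero_add, pow_zero, one_apply_eq_self] at this
      rw [← this]
      simp only [hW]
      congr 2
      push_cast; ring_nf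
    simp only [hU, e1, e2, map_add]
    rw [sub_eq_iff_eq_add.1 h1]
    abel
  have hWm : ∀ t n, Measurable (W t n) := fun t n => hm.comp (hZ.measurable _)
  have hind : ∀ t, iIndepFun (W t) μ := fun t =>
    (hZ.indep.precomp (g := fun n : ℕ => t + 1 + n) fun a b hab => by
      simpa using hab).comp _ fun _ => hm
  have hid : ∀ t n, IdentDistrib (W t n) (W t 0) μ μ := fun t n =>
    (hZ.identDistrib_of _ _).comp hm
  have hsum : ∑' n, μ {ω | 1 < ‖(Ring.inverse (unstableOp A) ^ n)
      ((Ring.inverse (unstableOp A) ^ (q + 1)) (unstableCoeff A q B (Z 0 ω)))‖} ≠ ⊤ := by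
    -- at time `-1` the first innovation of the recursion is `Z 0`
    have h := tsum_measure_pow_ne_top hT (hbd (-1)) (hrec (-1)) (hWm (-1)) (hind (-1)) (hid (-1))
    simpa [hW, hD] using h
  refine ⟨hsum, fun t => ?_⟩
  have hsumm := ae_summable_unstableTerm hA hZ hsum t
  have hsumm' : ∀ᵐ ω ∂μ, Summable fun n => ‖(Ring.inverse (unstableOp A) ^ n) (W t n ω)‖ := by
    filter_upwards [hsumm] with ω hω
    simpa only [hterm, norm_neg] using
      (summable_nat_add_iff (f := fun n => ‖unstableTerm A q B (fun s => Z s ω) t n‖) q).2 hω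
  filter_upwards [hsumm, ae_eq_tsum_of_recursion hT (hbd t) (hrec t) (hWm t) hsumm']
    with ω hs hω
  simp only [hterm, tsum_neg] at hω
  have h0 : unstablePart A (Y t ω) + unstableHead A q B (fun s => Z s ω) t q =
      -∑' n, unstableTerm A q B (fun s => Z s ω) t (n + q) := by
    simp only [hU, Nat.cast_zero, add_zero] at hω
    exact hω
  rw [unstableSol, ← hs.of_norm.sum_add_tsum_nat_add q, neg_add, ← h0, unstableHead]
  abel

end Solutions

/-! ### Existence under the moment condition, and its necessity -/

section Existence

variable {E : Type*} [NormedAddCommGroup E] [NormedSpace ℂ E] {A : E →L[ℂ] E}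
  {q : ℕ} {B : ℕ → E →L[ℂ] E}

/-- The series solution `S(X_t⁽¹⁾, X_t⁽²⁾)` as a function of the path of the noise. -/
def seriesSol (A : E →L[ℂ] E) (q : ℕ) (B : ℕ → E →L[ℂ] E) (z : ℤ → E) (t : ℤ) : E :=
  splitMap A (stableSol A q B z t, unstableSol A q B z t)

theorem seriesSol_shift (z : ℤ → E) (t h : ℤ) :
    seriesSol A q B z (t + h) = seriesSol A q B (fun s => z (s + h)) t := by
  have e : ∀ j : ℤ, t + h - j = t - j + h := fun j => by ring
  have e' : ∀ j : ℤ, t + h + j = t + j + h := fun j => by ring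
  simp only [seriesSol, stableSol, unstableSol, stableHead, stableTerm, unstableTerm, e, e']

variable [CompleteSpace E]

theorem measurable_seriesSol [TopologicalSpace.SeparableSpace E] [MeasurableSpace E]
    [BorelSpace E] (hA : spectrum ℂ A ∩ {z : ℂ | ‖z‖ = 1} = ∅) (t : ℤ) :
    Measurable fun z : ℤ → E => seriesSol A q B z t := by
  have : SecondCountableTopology E := UniformSpace.secondCountable_of_separable E
  have := completeSpace_stableSpace hA
  have := completeSpace_unstableSpace hA
  refine (splitMap A).continuous.measurable.comp (Measurable.prodMk ?_ ?_)
  · refine Measurable.add (Finset.measurable_fun_sum _ fun j _ => ?_)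
      (Measurable.tsum fun n => ?_)
    · exact (ContinuousLinearMap.continuous _).measurable.comp (measurable_pi_apply _)
    · exact (ContinuousLinearMap.continuous _).measurable.comp
        ((ContinuousLinearMap.continuous _).measurable.comp (measurable_pi_apply _))
  · refine (Measurable.tsum fun n => ?_).neg
    exact (ContinuousLinearMap.continuous _).measurable.comp
      ((ContinuousLinearMap.continuous _).measurable.comp (measurable_pi_apply _))

variable [TopologicalSpace.SeparableSpace E] [MeasurableSpace E] [BorelSpace E]
  {Ω : Type*} [MeasurableSpace Ω] {μ : Measure Ω} {Z Y : ℤ → Ω → E}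

theorem isStrictlyStationary_seriesSol (hA : spectrum ℂ A ∩ {z : ℂ | ‖z‖ = 1} = ∅)
    (hZ : IsIIDNoise Z μ) :
    IsStrictlyStationary (fun t ω => seriesSol A q B (fun s => Z s ω) t) μ := by
  intro s h
  have hm : Measurable fun (z : ℤ → E) (i : s) => seriesSol A q B z (i : ℤ) :=
    measurable_pi_lambda _ fun i => measurable_seriesSol hA _
  simp only [seriesSol_shift]
  exact (hZ.identDistrib_shift h).comp hm

variable [IsProbabilityMeasure μ]

theorem isStationarySolution_seriesSol (hA : spectrum ℂ A ∩ {z : ℂ | ‖z‖ = 1} = ∅)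
    (hZ : IsIIDNoise Z μ) (hlog : LogMoment A q B Z μ) :
    IsStationarySolution A q B Z (fun t ω => seriesSol A q B (fun s => Z s ω) t) μ where
  measurable t := (measurable_seriesSol hA t).comp (measurable_pi_lambda _ hZ.measurable)
  stationary := isStrictlyStationary_seriesSol hA hZ
  equation t := by
    have h₁ := lintegral_posLog_map_lt_top (stablePart A) hlog
    have h₂ := lintegral_posLog_map_lt_top
      ((Ring.inverse (unstableOp A) ^ (q + 1)) ∘L unstablePart A) hlog
    simp only [ContinuousLinearMap.comp_apply, ← stableCoeff_apply hA,
      ← unstableCoeff_apply hA] at h₁ h₂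
    have hs₁ := tsum_ne_top_of_lintegral_posLog_lt_top (isPowerContracting_stableOp hA)
      ((stableCoeff A q B).continuous.measurable.comp (hZ.measurable 0)) h₁
    have hs₂ := tsum_ne_top_of_lintegral_posLog_lt_top (isPowerContracting_inverse_unstableOp hA)
      (((Ring.inverse (unstableOp A) ^ (q + 1)) ∘L unstableCoeff A q B).continuous.measurable.comp
        (hZ.measurable 0)) h₂
    filter_upwards [ae_all_iff.2 (ae_summable_stableTerm hA hZ hs₁),
      ae_all_iff.2 (ae_summable_unstableTerm hA hZ hs₂)] with ω hω₁ hω₂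
    exact splitMap_sol_sub hA t hω₁ hω₂

theorem IsStationarySolution.ae_eq_seriesSol (hA : spectrum ℂ A ∩ {z : ℂ | ‖z‖ = 1} = ∅)
    (hZ : IsIIDNoise Z μ) (hY : IsStationarySolution A q B Z Y μ) (t : ℤ) :
    ∀ᵐ ω ∂μ, Y t ω = seriesSol A q B (fun s => Z s ω) t := by
  filter_upwards [(hY.stable_part hA hZ).2 t, (hY.unstable_part hA hZ).2 t] with ω h₁ h₂
  rw [seriesSol, ← h₁, ← h₂]
  exact (DFunLike.congr_fun (splitMap_comp_splitInv A) (Y t ω)).symm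

/-- If `0 ∉ σ(A)`, both `Λ₁` and `Λ₂⁻¹` are bounded below, so the summability that every stationary
solution forces gives logarithmic moments for the two components of `(∑ A^{q-k} B_k) Z_0`. -/
theorem IsStationarySolution.logMoment (hA : spectrum ℂ A ∩ {z : ℂ | ‖z‖ = 1} = ∅)
    (hZ : IsIIDNoise Z μ) (h0 : (0 : ℂ) ∉ spectrum ℂ A)
    (hY : IsStationarySolution A q B Z Y μ) : LogMoment A q B Z μ := by
  have : SecondCountableTopology E := UniformSpace.secondCountable_of_separable E
  have hu := isUnit_unstableOp hA
  have hs : IsUnit (stableOp A) := by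
    rw [← spectrum.zero_notMem_iff ℂ, spectrum_stableOp hA]
    exact fun h => h0 h.2
  have hm₁ : Measurable fun ω => stableCoeff A q B (Z 0 ω) :=
    (stableCoeff A q B).continuous.measurable.comp (hZ.measurable 0)
  have h₁ := lintegral_posLog_lt_top_of_tsum (Ring.inverse_mul_cancel _ hs) hm₁
    (hY.stable_part hA hZ).1
  have h₂ := lintegral_posLog_lt_top_of_tsum (Ring.mul_inverse_cancel _ hu)
    (((Ring.inverse (unstableOp A) ^ (q + 1)) ∘L unstableCoeff A q B).continuous.measurable.comp
      (hZ.measurable 0)) (hY.unstable_part hA hZ).1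
  have h₃ := lintegral_posLog_add_lt_top
    ((stableSpace A).subtypeL.continuous.measurable.comp hm₁)
    (lintegral_posLog_map_lt_top (stableSpace A).subtypeL h₁)
    (lintegral_posLog_map_lt_top ((unstableSpace A).subtypeL ∘L (unstableOp A ^ (q + 1))) h₂)
  have hpow : unstableOp A ^ (q + 1) * Ring.inverse (unstableOp A) ^ (q + 1) = 1 := by
    have hcomm : Commute (unstableOp A) (Ring.inverse (unstableOp A)) :=
      (Ring.mul_inverse_cancel _ hu).trans (Ring.inverse_mul_cancel _ hu).symm
    rw [← hcomm.mul_pow, Ring.mul_inverse_cancel _ hu, one_pow]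
  unfold LogMoment
  convert! h₃ using 5 with ω
  have e1 := DFunLike.congr_fun hpow (unstableCoeff A q B (Z 0 ω))
  set D := ∑ k ∈ Finset.range (q + 1), (A ^ (q - k)) ∘L B k
  have e2 := DFunLike.congr_fun (splitMap_comp_splitInv A) (D (Z 0 ω))
  change splitMap A (stablePart A (D (Z 0 ω)), unstablePart A (D (Z 0 ω))) = D (Z 0 ω) at e2
  rw [← stableCoeff_apply hA, ← unstableCoeff_apply hA] at e2
  rw [← e2]
  exact congrArg (fun u : unstableSpace A => ‖(stableCoeff A q B (Z 0 ω) : E) + u‖) e1.symm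

end Existence

end ARMA

end

theorem theorem1 {E : Type*} [NormedAddCommGroup E] [NormedSpace ℂ E] [CompleteSpace E]
    [TopologicalSpace.SeparableSpace E] [MeasurableSpace E] [BorelSpace E]
    {Ω : Type*} [MeasurableSpace Ω] (μ : Measure Ω) [IsProbabilityMeasure μ]
    (Z : ℤ → Ω → E) (hZ : ARMA.IsIIDNoise Z μ)
    (A : E →L[ℂ] E) (q : ℕ) (B : ℕ → E →L[ℂ] E)
    (hA : spectrum ℂ A ∩ {z : ℂ | ‖z‖ = 1} = ∅) :
    -- the splitting: `S` is an isomorphism and `S⁻¹ A S = Λ₁ ⊕ Λ₂` with the stated spectra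
    (ARMA.splitMap A ∘L ARMA.splitInv A = ContinuousLinearMap.id ℂ _ ∧
      ARMA.splitInv A ∘L ARMA.splitMap A = ContinuousLinearMap.id ℂ _ ∧
      ARMA.splitInv A ∘L A ∘L ARMA.splitMap A =
        (ARMA.stableOp A).prodMap (ARMA.unstableOp A) ∧
      spectrum ℂ (ARMA.stableOp A) = {z : ℂ | ‖z‖ < 1} ∩ spectrum ℂ A ∧
      spectrum ℂ (ARMA.unstableOp A) = {z : ℂ | 1 < ‖z‖} ∩ spectrum ℂ A) ∧
    -- sufficiency of the moment condition
    (ARMA.LogMoment A q B Z μ → ∃ Y : ℤ → Ω → E, ARMA.IsStationarySolution A q B Z Y μ) ∧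
    -- necessity when `0 ∉ σ(A)`
    ((0 : ℂ) ∉ spectrum ℂ A →
      (∃ Y : ℤ → Ω → E, ARMA.IsStationarySolution A q B Z Y μ) → ARMA.LogMoment A q B Z μ) ∧
    -- uniqueness
    (∀ Y Y' : ℤ → Ω → E, ARMA.IsStationarySolution A q B Z Y μ →
      ARMA.IsStationarySolution A q B Z Y' μ → ∀ t : ℤ, ∀ᵐ ω ∂μ, Y t ω = Y' t ω) ∧
    -- the solution is given by almost surely absolutely convergent series
    (∀ Y : ℤ → Ω → E, ARMA.IsStationarySolution A q B Z Y μ → ∀ t : ℤ, ∀ᵐ ω ∂μ,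
      Summable (fun n : ℕ => ‖ARMA.stableTerm A q B (fun s => Z s ω) t n‖) ∧
      Summable (fun n : ℕ => ‖ARMA.unstableTerm A q B (fun s => Z s ω) t n‖) ∧
      Y t ω = ARMA.splitMap A
        (ARMA.stableSol A q B (fun s => Z s ω) t, ARMA.unstableSol A q B (fun s => Z s ω) t)) := by
  refine ⟨⟨ARMA.splitMap_comp_splitInv A, ARMA.splitInv_comp_splitMap hA,
    ARMA.splitInv_comp_comp_splitMap hA, ARMA.spectrum_stableOp hA,
    ARMA.spectrum_unstableOp hA⟩, fun hlog => ⟨_, ARMA.isStationarySolution_seriesSol hA hZ hlog⟩,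
    fun h0 ⟨Y, hY⟩ => hY.logMoment hA hZ h0, fun Y Y' hY hY' t => ?_, fun Y hY t => ?_⟩
  · filter_upwards [hY.ae_eq_seriesSol hA hZ t, hY'.ae_eq_seriesSol hA hZ t] with ω h h'
    rw [h, h']
  · filter_upwards [ARMA.ae_summable_stableTerm hA hZ (hY.stable_part hA hZ).1 t,
      ARMA.ae_summable_unstableTerm hA hZ (hY.unstable_part hA hZ).1 t,
      hY.ae_eq_seriesSol hA hZ t] with ω h₁ h₂ h
    exact ⟨h₁, h₂, h⟩
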